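/- \textbf{Definitions.} An \emph{affine counter system} with $n\ge 0$ counters consists of a finite set $Q$ of control states, a finite set $R$ of Presburger-definable relations on $\mathbb{N}^n\times\mathbb{N}^n$, each of which is the graph of a partial function $f:\mathbb{N}^n\to\mathbb{N}^n$ such that for some $A\in\mathbb{N}^{n\times n}$ and $b\in\mathbb{Z}^n$ one has $f(x)=Ax+b$ for all $x\in\operatorname{dom} f$, and a set ${\to}\subseteq Q\times R\times Q$ of transitions. It defines a functional transition system $S$ on $Q\times\mathbb{N}^n$: each transition $(p,f,q)$ gives the partial map $(p,x)\mapsto(q,f(x))$ with domain $\{p\}\times\operatorname{dom} f$. States are ordered by $(p,x)\le(q,y)$ iff $p=q$ and $x\le y$ componentwise. $S$ is a \emph{strongly monotonic WSTS}, in the sense of functional systems, if the order is a well partial order, each of its transition maps $h$ is partial monotonic (that is, $\operatorname{dom} h$ is upward-closed and $h$ is monotonic on it), and the transition relation is strongly monotonic (if $s\to s'$ and $s\le s_1$, then $s_1\to s_1'$ for some $s_1'\ge s'$, and so in particular it is monotonic). Let $\mathbb{N}_\omega=\mathbb{N}\cup\{\omega\}$. The \emph{completion} $\widehat S$ is the functional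 transition system on $Q\times\mathbb{N}_\omega^n$ (ordered in the same way) obtained by replacing each $f$ by its extension by continuity $\overline f$: the domain of $\overline f$ is the set of suprema in $\mathbb{N}_\omega^n$ of countable chains $x_0\le x_1\le\cdots$ in $\operatorname{dom} f$, and $\overline f(\sup_i x_i)=\sup_i f(x_i)$. A partial map on a dcpo is \emph{partial continuous} if its domain is Scott-open and it preserves the suprema of the (non-empty) directed subsets of its domain. A functional transition system is a \emph{complete WSTS} if its order is a well partial order and a continuous dcpo, all its transition maps are partial monotonic and partial continuous, and its transition relation is monotonic. The \emph{lub-acceleration} $g^\infty$ of a partial map $g$ has the domain of $g$, with $g^\infty(x)=\sup_{m\ge 0} g^m(x)$ if $x<g(x)$, and $g^\infty(x)=g(x)$ otherwise. A complete WSTS is \emph{$\infty$-effective} with respect to a representation of its states (a surjection from a set of natural numbers, the codes, onto the set of states) if on codes the ordering is decidable, every transition map is computable, and $g^\infty$ is computable for every composition $g$ of finitely many transition maps. A partial map $h$ is computable if there is an algorithm that, given a code of a state $s$, decides whether $s\in\operatorname{dom} h$ and, if so, returns a code of $h(s)$. \textbf{Theorem.} For every affine counter system, with associated transition system $S$, the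 following are equivalent: (i) the completion $\widehat S$ is an $\infty$-effective complete WSTS with respect to the standard coding of $Q\times\mathbb{N}_\omega^n$ by natural numbers; (ii) $\widehat S$ is an $\infty$-effective complete WSTS with respect to some representation of its states; (iii) $S$ is a strongly monotonic WSTS in the above sense; (iv) every affine map that labels a transition has an upward-closed domain. -/

import Mathlib

namespace CounterSystems

/-! ### Ordered transition systems given by finitely many partial functions -/

/-- A functional transition system on `S`: a finite set of partial functions on `S`. -/
structure FunctionalTS (S : Type*) where
  maps : Set (S →. S)
  finite_maps : maps.Finite

/-- The transition relation of a functional transition system. -/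
def FunctionalTS.Step {S : Type*} (T : FunctionalTS S) (s s' : S) : Prop :=
  ∃ f ∈ T.maps, s' ∈ f s

section Order

variable {S : Type*} [PartialOrder S]

/-- A partial function is partial monotonic: its domain is upward-closed and it is monotonic
on its domain. -/
def PartialMonotone (f : S →. S) : Prop :=
  IsUpperSet f.Dom ∧ ∀ x y x' y' : S, x ≤ y → x' ∈ f x → y' ∈ f y → x' ≤ y'

/-- Monotonicity: a larger state can simulate a step by finitely many steps. -/
def FunctionalTS.IsMonotonic (T : FunctionalTS S) : Prop :=
  ∀ s s' s₁ : S, T.Step s s' → s ≤ s₁ →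
    ∃ s₁' : S, Relation.ReflTransGen T.Step s₁ s₁' ∧ s' ≤ s₁'

/-- Strong monotonicity: a larger state can simulate a step by exactly one step. -/
def FunctionalTS.IsStronglyMonotonic (T : FunctionalTS S) : Prop :=
  ∀ s s' s₁ : S, T.Step s s' → s ≤ s₁ → ∃ s₁' : S, T.Step s₁ s₁' ∧ s' ≤ s₁'

/-- A well-structured transition system: monotonic, on a well partial order. -/
def FunctionalTS.IsWSTS (T : FunctionalTS S) : Prop :=
  T.IsMonotonic ∧ WellQuasiOrderedLE S

/-- A functional WSTS: all transition maps are partial monotonic, and the order is well. -/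
def FunctionalTS.IsFunctionalWSTS (T : FunctionalTS S) : Prop :=
  (∀ f ∈ T.maps, PartialMonotone f) ∧ T.IsWSTS

/-- A strongly monotonic WSTS, in the sense of functional systems: strong monotonicity of the
transition relation, together with partial monotonicity of each of the transition maps. -/
def FunctionalTS.IsStronglyMonotonicWSTS (T : FunctionalTS S) : Prop :=
  T.IsFunctionalWSTS ∧ T.IsStronglyMonotonic

/-! ### Continuous dcpos and complete systems -/

/-- Directed complete partial orders (directed sets are non-empty). -/
def IsDcpo (S : Type*) [PartialOrder S] : Prop :=
  ∀ D : Set S, D.Nonempty → DirectedOn (· ≤ ·) D → ∃ z, IsLUB D z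

/-- The way-below relation. -/
def WayBelow (x y : S) : Prop :=
  ∀ D : Set S, D.Nonempty → DirectedOn (· ≤ ·) D → ∀ z, IsLUB D z → y ≤ z → ∃ d ∈ D, x ≤ d

/-- Continuous dcpos: the elements way below `x` form a directed set with supremum `x`. -/
def IsContinuousDcpo (S : Type*) [PartialOrder S] : Prop :=
  IsDcpo S ∧ ∀ x : S, {y : S | WayBelow y x}.Nonempty ∧
    DirectedOn (· ≤ ·) {y : S | WayBelow y x} ∧ IsLUB {y : S | WayBelow y x} x

/-- A continuous directed complete well order. -/
def IsContinuousDcwo (S : Type*) [PartialOrder S] : Prop :=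
  IsContinuousDcpo S ∧ WellQuasiOrderedLE S

/-- A set is Scott-open: upward-closed and inaccessible by directed suprema. -/
def IsScottOpen (U : Set S) : Prop :=
  IsUpperSet U ∧ DirSupInacc U

/-- A partial continuous map: Scott-open domain, and preservation of the suprema of the
directed subsets of the domain. -/
def PartialContinuous (f : S →. S) : Prop :=
  IsScottOpen f.Dom ∧
    ∀ D : Set S, D.Nonempty → DirectedOn (· ≤ ·) D → D ⊆ f.Dom →
      ∀ z, IsLUB D z → ∃ w ∈ f z, IsLUB (f.image D) w

/-- A complete WSTS: a functional WSTS on a continuous dcwo, with partial continuous maps. -/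
def FunctionalTS.IsCompleteWSTS (T : FunctionalTS S) : Prop :=
  T.IsFunctionalWSTS ∧ IsContinuousDcwo S ∧ ∀ f ∈ T.maps, PartialContinuous f

/-! ### Lub-accelerations and compositions -/

/-- The iterates of a partial function. -/
def iter {S : Type*} (f : S →. S) : ℕ → (S →. S)
  | 0 => PFun.id S
  | m + 1 => f.comp (iter f m)

open Classical in
/-- The lub-acceleration of `f`. It has the domain of `f`; it sends `x` to the supremum of
all `f ^ m (x)` if `x < f x`, and to `f x` otherwise. (For `f` partial continuous on a dcpo the
supremum exists whenever `x < f x`, so that the innermost `else` is never used.) -/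
noncomputable def accel (f : S →. S) : S →. S := fun x =>
  ⟨(f x).Dom, fun h =>
    if x < (f x).get h then
      if hs : ∃ z, IsLUB {y | ∃ m : ℕ, y ∈ iter f m x} z then hs.choose else x
    else (f x).get h⟩

/-- The compositions of transition maps (the empty composition is the identity). -/
inductive FunctionalTS.IsComposition {S : Type*} (T : FunctionalTS S) : (S →. S) → Prop
  | id : T.IsComposition (PFun.id S)
  | comp (f g : S →. S) : f ∈ T.maps → T.IsComposition g → T.IsComposition (f.comp g)

end Order

/-! ### Effectivity -/

/-- A representation map: a surjection from a set of natural numbers (the codes) onto `S`. -/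
structure Representation (S : Type*) where
  codes : Set ℕ
  toState : codes → S
  surjective : Function.Surjective toState

/-- The representation of `S` given by an injective coding of its elements. -/
noncomputable def Representation.ofInjective {S : Type*} (code : S → ℕ)
    (h : Function.Injective code) : Representation S where
  codes := Set.range code
  toState := (Equiv.ofInjective code h).symm
  surjective := (Equiv.ofInjective code h).symm.surjective

/-- `f` is computable with respect to `ρ`: there is a partial recursive function that, on every
code of a state `s`, halts, decides whether `s` is in the domain of `f`, and if so, returns a
code of `f s`. -/
def Representation.ComputableMap {S : Type*} (ρ : Representation S) (f : S →. S) : Prop :=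
  ∃ φ : ℕ →. Option ℕ, Partrec φ ∧ ∀ e : ρ.codes,
    ((f (ρ.toState e)).Dom → ∃ e' : ρ.codes, some (e' : ℕ) ∈ φ e ∧ ρ.toState e' ∈ f (ρ.toState e)) ∧
    (¬ (f (ρ.toState e)).Dom → none ∈ φ e)

/-- The ordering is decidable on codes. -/
def Representation.DecidableOrder {S : Type*} [PartialOrder S] (ρ : Representation S) : Prop :=
  ∃ φ : ℕ × ℕ →. Bool, Partrec φ ∧ ∀ e e' : ρ.codes,
    ∃ b ∈ φ (e, e'), (b = true ↔ ρ.toState e ≤ ρ.toState e')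

/-- An ordered functional system is effective: decidable ordering, computable maps. -/
def FunctionalTS.IsEffective {S : Type*} [PartialOrder S] (T : FunctionalTS S)
    (ρ : Representation S) : Prop :=
  ρ.DecidableOrder ∧ ∀ f ∈ T.maps, ρ.ComputableMap f

/-- An `∞`-effective complete WSTS: an effective complete WSTS in which the lub-acceleration of
every composition of transition maps is computable. -/
def FunctionalTS.IsInftyEffectiveCompleteWSTS {S : Type*} [PartialOrder S] (T : FunctionalTS S)
    (ρ : Representation S) : Prop :=
  T.IsCompleteWSTS ∧ T.IsEffective ρ ∧ ∀ g, T.IsComposition g → ρ.ComputableMap (accel g)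

/-! ### Counter systems -/

/-- Binary relations on `ℕ ^ n`. -/
abbrev CounterRel (n : ℕ) := Set ((Fin n → ℕ) × (Fin n → ℕ))

/-- A relation on `ℕ ^ n` is Presburger: it is first-order definable in `(ℕ, 0, 1, +)`. -/
def IsPresburger {n : ℕ} (r : CounterRel n) : Prop :=
  (∅ : Set ℕ).Definable FirstOrder.Language.presburger
    {v : Fin n ⊕ Fin n → ℕ | (fun i => v (Sum.inl i), fun i => v (Sum.inr i)) ∈ r}

/-- A relational counter system with `n` counters and control states `Q`. -/
structure RCounterSystem (Q : Type*) (n : ℕ) where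
  rels : Set (CounterRel n)
  finite_rels : rels.Finite
  presburger : ∀ r ∈ rels, IsPresburger r
  trans : Set (Q × CounterRel n × Q)
  trans_rel : ∀ t ∈ trans, t.2.1 ∈ rels

/-- A relation on `ℕ ^ n` is (the graph of) a partial non-negative affine function: it is
functional, and on its domain of the form `x ↦ A x + b`, where `A` has entries in `ℕ` and
`b` has entries in `ℤ`. -/
def IsPartialAffine {n : ℕ} (r : CounterRel n) : Prop :=
  (∀ x y y', (x, y) ∈ r → (x, y') ∈ r → y = y') ∧
    ∃ (A : Matrix (Fin n) (Fin n) ℕ) (b : Fin n → ℤ), ∀ x y, (x, y) ∈ r →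
      ∀ i, (y i : ℤ) = ((A.mulVec x) i : ℤ) + b i

/-- An affine counter system. -/
structure AffineCounterSystem (Q : Type*) (n : ℕ) extends RCounterSystem Q n where
  affine : ∀ r ∈ rels, IsPartialAffine r

/-- The partial function whose graph is the functional relation `r`. -/
noncomputable def relFun {n : ℕ} (r : CounterRel n) : (Fin n → ℕ) →. (Fin n → ℕ) := fun x =>
  ⟨∃ y, (x, y) ∈ r, fun h => h.choose⟩

/-- The inclusion of `ℕ ^ n` into `ℕ_ω ^ n`, where `ℕ_ω` is `ℕ` with a top element. -/
def emb {n : ℕ} (x : Fin n → ℕ) : Fin n → ℕ∞ := fun i => (x i : ℕ∞)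

/-- The extension by continuity of a partial function `f` on `ℕ ^ n` to `ℕ_ω ^ n`. Its domain
consists of the suprema of the countable chains in the domain of `f`, and its value at `y` is
the supremum of the values of `f` below `y`; see `contExt_chain` for the characterization
`f (⨆ i, u i) = ⨆ i, f (u i)`, and `contExt_dom_of_isUpperSet` for the domain when that of `f` is
upward-closed. -/
noncomputable def contExt {n : ℕ} (f : (Fin n → ℕ) →. (Fin n → ℕ)) :
    (Fin n → ℕ∞) →. (Fin n → ℕ∞) := fun y =>
  ⟨∃ u : ℕ → Fin n → ℕ, Monotone u ∧ (∀ i, u i ∈ f.Dom) ∧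
      IsLUB (Set.range fun i => emb (u i)) y,
    fun _ => sSup (emb '' f.image {x | emb x ≤ y})⟩

/-- If a chain of natural vectors has a supremum above `x`, some member is above `x`. -/
theorem exists_le_of_emb_le {n : ℕ} {u : ℕ → Fin n → ℕ} (hu : Monotone u) {y : Fin n → ℕ∞}
    (hy : IsLUB (Set.range fun i => emb (u i)) y) {x : Fin n → ℕ} (hx : emb x ≤ y) :
    ∃ i, x ≤ u i := by
  have key : ∀ j : Fin n, ∃ i, x j ≤ u i j := by
    intro j
    by_contra hcon
    push Not at hcon
    have hub : Function.update y j ((x j - 1 : ℕ) : ℕ∞) ∈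
        upperBounds (Set.range fun i => emb (u i)) := by
      rintro _ ⟨i, rfl⟩ k
      by_cases hk : k = j
      · subst hk
        have := hcon i
        simp only [emb, Function.update_self, Nat.cast_le]
        omega
      · simpa [Function.update_of_ne hk] using hy.1 ⟨i, rfl⟩ k
    have h1 := hy.2 hub j
    have h2 := (hx j).trans h1
    simp only [emb, Function.update_self, Nat.cast_le] at h2
    have := hcon 0
    omega
  choose g hg using key
  refine ⟨Finset.univ.sup g, fun j => (hg j).trans ?_⟩
  exact hu (Finset.le_sup (Finset.mem_univ j)) j

/-- The extension commutes with suprema of chains in the domain of `f`, for every `f` that is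
monotonic on its domain (in particular for every affine `f`). -/
theorem contExt_chain {n : ℕ} (f : (Fin n → ℕ) →. (Fin n → ℕ))
    (hf : ∀ x y x' y', x ≤ y → x' ∈ f x → y' ∈ f y → x' ≤ y')
    (u v : ℕ → Fin n → ℕ) (hu : Monotone u) (hv : ∀ i, v i ∈ f (u i)) (y : Fin n → ℕ∞)
    (hy : IsLUB (Set.range fun i => emb (u i)) y) :
    ∃ z ∈ contExt f y, IsLUB (Set.range fun i => emb (v i)) z := by
  refine ⟨_, ⟨⟨u, hu, fun i => Part.dom_iff_mem.2 ⟨_, hv i⟩, hy⟩, rfl⟩, ?_, ?_⟩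
  · rintro _ ⟨i, rfl⟩
    exact le_sSup ⟨v i, ⟨u i, hy.1 ⟨i, rfl⟩, hv i⟩, rfl⟩
  · intro w hw
    refine sSup_le ?_
    rintro _ ⟨x', ⟨x, hx, hx'⟩, rfl⟩
    obtain ⟨i, hi⟩ := exists_le_of_emb_le hu hy hx
    refine le_trans (fun k => ?_) (hw ⟨i, rfl⟩)
    exact Nat.cast_le.2 (hf _ _ _ _ hi hx' (hv i) k)

/-- When the domain of `f` is upward-closed, the domain of the extension consists of
all `y` that are above some element of the domain of `f`. -/
theorem contExt_dom_of_isUpperSet {n : ℕ} (f : (Fin n → ℕ) →. (Fin n → ℕ))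
    (hf : IsUpperSet f.Dom) :
    (contExt f).Dom = {y | ∃ x ∈ f.Dom, emb x ≤ y} := by
  ext y
  constructor
  · rintro ⟨u, -, hd, hl⟩
    exact ⟨u 0, hd 0, hl.1 ⟨0, rfl⟩⟩
  · rintro ⟨x, hx, hxy⟩
    refine ⟨fun i k => max (x k) (min (y k) (i : ℕ∞)).toNat, ?_, ?_, ?_, ?_⟩
    · intro i j hij k
      refine max_le_max le_rfl (ENat.toNat_le_toNat ?_ ?_)
      · exact min_le_min le_rfl (Nat.cast_le.2 hij)
      · exact ne_top_of_le_ne_top (ENat.natCast_ne_top j) (min_le_right _ _)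
    · exact fun i => hf (fun k => le_max_left _ _) hx
    · rintro _ ⟨i, rfl⟩ k
      simp only [emb]
      rw [Nat.mono_cast.map_max]
      refine max_le (hxy k) ((ENat.natCast_toNat_le_self _).trans (min_le_left _ _))
    · intro w hw k
      refine ENat.forall_natCast_le_iff_le.1 fun m hm => ?_
      have h := hw ⟨m, rfl⟩ k
      simp only [emb] at h
      refine le_trans ?_ h
      rw [min_eq_right hm]
      simp

/-- States: a control state with a vector. States with distinct control states
are incomparable, those with the same control state are compared componentwise. -/
abbrev State (Q : Type*) (V : Type*) := (_ : Q) × V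

/-- The partial function on states of a transition from `p` to `q` labelled by `f`. -/
def liftMap {Q V : Type*} (p : Q) (f : V →. V) (q : Q) : State Q V →. State Q V := fun s =>
  ⟨s.1 = p ∧ (f s.2).Dom, fun h => ⟨q, (f s.2).get h.2⟩⟩

theorem RCounterSystem.finite_trans {Q : Type*} [Finite Q] {n : ℕ} (C : RCounterSystem Q n) :
    C.trans.Finite := by
  refine Set.Finite.subset
    (Set.finite_univ.prod (C.finite_rels.prod (Set.finite_univ (α := Q)))) ?_
  intro t ht
  exact ⟨Set.mem_univ _, C.trans_rel t ht, Set.mem_univ _⟩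

/-- The functional transition system of an affine counter system, with states `Q × ℕ ^ n`. -/
noncomputable def AffineCounterSystem.system {Q : Type*} [Finite Q] {n : ℕ}
    (C : AffineCounterSystem Q n) : FunctionalTS (State Q (Fin n → ℕ)) where
  maps := (fun t => liftMap t.1 (relFun t.2.1) t.2.2) '' C.trans
  finite_maps := C.finite_trans.image _

/-- The completion of an affine counter system, with states `Q × ℕ_ω ^ n`; each
affine map is replaced by its extension by continuity. -/
noncomputable def AffineCounterSystem.completion {Q : Type*} [Finite Q] {n : ℕ}
    (C : AffineCounterSystem Q n) : FunctionalTS (State Q (Fin n → ℕ∞)) where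
  maps := (fun t => liftMap t.1 (contExt (relFun t.2.1)) t.2.2) '' C.trans
  finite_maps := C.finite_trans.image _

/-- The affine maps that label transitions all have upward-closed domains. -/
def AffineCounterSystem.UpwardClosedDomains {Q : Type*} {n : ℕ}
    (C : AffineCounterSystem Q n) : Prop :=
  ∀ t ∈ C.trans, IsUpperSet {x : Fin n → ℕ | ∃ y, (x, y) ∈ t.2.1}

/-! ### The standard coding of `Q × ℕ_ω ^ n` -/

/-- The code of an element of `ℕ_ω`: `ω` is coded by `0`, and `m` by `m + 1`. -/
def omegaCode (m : ℕ∞) : ℕ :=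
  if m = ⊤ then 0 else m.toNat + 1

theorem omegaCode_injective : Function.Injective omegaCode := by
  intro a b h
  cases a <;> cases b <;> simp_all [omegaCode]

/-- The code of a state: the code of its control state (for a numbering of the finite
set `Q`), paired with the code of the list of its coordinates. -/
noncomputable def stateCode {Q : Type*} [Finite Q] {n : ℕ} (s : State Q (Fin n → ℕ∞)) : ℕ :=
  Nat.pair (Finite.equivFin Q s.1) (Encodable.encode (List.ofFn fun i => omegaCode (s.2 i)))

theorem stateCode_injective {Q : Type*} [Finite Q] {n : ℕ} :
    Function.Injective (stateCode : State Q (Fin n → ℕ∞) → ℕ) := by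
  rintro ⟨p, x⟩ ⟨q, y⟩ h
  obtain ⟨h1, h2⟩ := Nat.pair_eq_pair.1 h
  have hp : p = q := (Finite.equivFin Q).injective (Fin.ext h1)
  have hx : x = y := by
    have := List.ofFn_injective (Encodable.encode_injective h2)
    funext i
    exact omegaCode_injective (congrFun this i)
  subst hp hx
  rfl

/-- The standard representation of `Q × ℕ_ω ^ n`. -/
noncomputable def stdRep (Q : Type*) [Finite Q] (n : ℕ) :
    Representation (State Q (Fin n → ℕ∞)) :=
  Representation.ofInjective stateCode stateCode_injective

end CounterSystems

/-!
Three of the implications are short. If the labels of an affine counter system have upward-closed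
domains, then its transition maps, being non-negative affine, are partial monotonic, which gives
strong monotonicity, and the order is well by Dickson's lemma; the converse is part of the
definition (`AffineCounterSystem.isStronglyMonotonicWSTS_iff`). A chain of natural vectors with a
natural supremum is eventually constant, so the domain of an extension by continuity meets `ℕ ^ n`
in the original domain (`emb_mem_contExt_dom`); hence the domains of the labels are upward-closed
as soon as those of the completed maps are, whatever the representation of the states.

It remains to show that, for upward-closed domains, the completion is `∞`-effective for the standard
coding. The order theory rests on the compactness of natural vectors in `ℕ_ω ^ n`
(`exists_mem_emb_le_of_directedOn`): it identifies the way-below relation, and makes the extensions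
partial continuous. By Dickson's lemma the domain of an extended map is decided by finitely many
natural vectors (`exists_finite_basis`), and on that domain the map is given by the affine formula
computed in `ℕ_ω` (`contExt_relFun_add`), so it is primitive recursive
(`liftMap_contExt_primrecMap`).

For the acceleration of a composition `g`, matrices are not needed, only the dependency relation
`D` between coordinates (`HasDependency`): coordinate `i` of `g x` is `ω` iff some `x j` with `D i j`
is, and, if finite, it increases strictly with `x` iff some such `x j` does. This property holds
for the extended affine maps and is preserved by composition. Along an increasing orbit
`x, g x, g (g x), …` it means that the pair of the set of infinite coordinates and the set of
coordinates about to increase evolves deterministically. There are `4 ^ n` such pairs, so the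
sequence of pairs is periodic, with period at most `4 ^ n`, from an index at most `4 ^ n` on. A coordinate
therefore has supremum `ω` if it differs at the indices `4 ^ n` and `2 * 4 ^ n`, and is constant from
the first of them otherwise (`isLUB_range_of_dependency`). So `g^∞` is computed by two iterates of
`g` of fixed order (`PrimrecMap.accel`).
-/

namespace CounterSystems

/-! ### Extension by continuity -/

theorem emb_le_emb {n : ℕ} {x y : Fin n → ℕ} : emb x ≤ emb y ↔ x ≤ y := by
  simp [emb, Pi.le_def]

/-- Every element of `ℕ_ω ^ n` is determined by the natural vectors below it. -/
theorem le_of_forall_emb_le {n : ℕ} {y w : Fin n → ℕ∞} (h : ∀ x, emb x ≤ y → emb x ≤ w) :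
    y ≤ w := by
  intro k
  refine ENat.forall_natCast_le_iff_le.1 fun m hm => ?_
  have h1 := h (Pi.single k m) (fun j => ?_) k
  · simpa [emb] using h1
  · by_cases hj : j = k
    · subst hj; simpa [emb] using hm
    · simp [emb, Pi.single_eq_of_ne hj]

/-- Natural vectors are compact: a natural vector below the supremum of a directed set is
below one of its members. -/
theorem exists_mem_emb_le_of_directedOn {n : ℕ} {D : Set (Fin n → ℕ∞)} (hne : D.Nonempty)
    (hD : DirectedOn (· ≤ ·) D) {z : Fin n → ℕ∞} (hz : IsLUB D z) {x : Fin n → ℕ}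
    (hx : emb x ≤ z) : ∃ d ∈ D, emb x ≤ d := by
  have key : ∀ j : Fin n, ∃ d ∈ D, (x j : ℕ∞) ≤ d j := by
    intro j
    rcases Nat.eq_zero_or_pos (x j) with h0 | hpos
    · obtain ⟨d, hd⟩ := hne
      exact ⟨d, hd, by simp [h0]⟩
    have hlt : ((x j - 1 : ℕ) : ℕ∞) < z j :=
      lt_of_lt_of_le (Nat.cast_lt.2 (by omega)) (hx j)
    obtain ⟨_, ⟨d, hd, rfl⟩, hlt'⟩ := (lt_isLUB_iff (isLUB_pi.1 hz j)).1 hlt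
    refine ⟨d, hd, ?_⟩
    have h1 : ((x j - 1 : ℕ) : ℕ∞) + 1 ≤ d j := Order.add_one_le_of_lt hlt'
    have h2 : ((x j - 1 : ℕ) : ℕ∞) + 1 = x j := by
      exact_mod_cast Nat.sub_add_cancel hpos
    exact h2 ▸ h1
  choose g hgD hg using key
  obtain ⟨d, hd, hle⟩ : ∃ d ∈ D, ∀ j ∈ (Finset.univ : Finset (Fin n)), g j ≤ d := by
    refine Finset.induction_on (Finset.univ : Finset (Fin n)) ?_ ?_
    · obtain ⟨d, hd⟩ := hne
      exact ⟨d, hd, by simp⟩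
    · rintro a s - ⟨d, hd, hs⟩
      obtain ⟨e, he, h1, h2⟩ := hD _ (hgD a) d hd
      refine ⟨e, he, fun j hj => ?_⟩
      rcases Finset.mem_insert.1 hj with rfl | hj
      · exact h1
      · exact (hs j hj).trans h2
  exact ⟨d, hd, fun j => (hg j).trans (hle j (Finset.mem_univ j) j)⟩

/-- The domain of the extension meets `ℕ ^ n` in the original domain, since a chain with a
natural supremum is eventually constant. -/
theorem emb_mem_contExt_dom {n : ℕ} {f : (Fin n → ℕ) →. (Fin n → ℕ)} {x : Fin n → ℕ} :
    emb x ∈ (contExt f).Dom ↔ x ∈ f.Dom := by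
  constructor
  · rintro ⟨u, hu, hd, hl⟩
    obtain ⟨i, hi⟩ := exists_le_of_emb_le hu hl le_rfl
    have : u i = x := le_antisymm (emb_le_emb.1 (hl.1 ⟨i, rfl⟩)) hi
    exact this ▸ hd i
  · intro h
    exact ⟨fun _ => x, monotone_const, fun _ => h, by simp⟩

theorem eq_sSup_of_mem_contExt {n : ℕ} {f : (Fin n → ℕ) →. (Fin n → ℕ)} {y z : Fin n → ℕ∞}
    (h : z ∈ contExt f y) : z = sSup (emb '' f.image {x | emb x ≤ y}) := by
  obtain ⟨_, rfl⟩ := h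
  rfl

theorem contExt_mono {n : ℕ} {f : (Fin n → ℕ) →. (Fin n → ℕ)} {y y' z z' : Fin n → ℕ∞}
    (hy : y ≤ y') (hz : z ∈ contExt f y) (hz' : z' ∈ contExt f y') : z ≤ z' := by
  rw [eq_sSup_of_mem_contExt hz, eq_sSup_of_mem_contExt hz']
  refine sSup_le_sSup (Set.image_mono ?_)
  rintro _ ⟨x, hx, h⟩
  exact ⟨x, hx.trans hy, h⟩

theorem contExt_partialMonotone {n : ℕ} {f : (Fin n → ℕ) →. (Fin n → ℕ)}
    (hf : IsUpperSet f.Dom) : PartialMonotone (contExt f) := by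
  refine ⟨?_, fun x y x' y' => contExt_mono⟩
  rw [contExt_dom_of_isUpperSet f hf]
  rintro y y' hy ⟨x, hx, hxy⟩
  exact ⟨x, hx, hxy.trans hy⟩

theorem contExt_partialContinuous {n : ℕ} {f : (Fin n → ℕ) →. (Fin n → ℕ)}
    (hf : IsUpperSet f.Dom) : PartialContinuous (contExt f) := by
  have hup := (contExt_partialMonotone hf).1
  refine ⟨⟨hup, ?_⟩, ?_⟩
  · intro D hne hD z hz hzd
    rw [contExt_dom_of_isUpperSet f hf] at hzd ⊢
    obtain ⟨x, hx, hxz⟩ := hzd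
    obtain ⟨d, hd, hxd⟩ := exists_mem_emb_le_of_directedOn hne hD hz hxz
    exact ⟨d, hd, x, hx, hxd⟩
  · intro D hne hD hDd z hz
    have hzd : z ∈ (contExt f).Dom := by
      obtain ⟨d, hd⟩ := hne
      exact hup (hz.1 hd) (hDd hd)
    refine ⟨_, ⟨hzd, rfl⟩, ?_, ?_⟩
    · rintro w ⟨d, hd, hw⟩
      exact contExt_mono (hz.1 hd) hw ⟨hzd, rfl⟩
    · intro w hw
      refine sSup_le ?_
      rintro _ ⟨v, ⟨x, hx, hv⟩, rfl⟩
      obtain ⟨d, hd, hxd⟩ := exists_mem_emb_le_of_directedOn hne hD hz hx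
      refine le_trans ?_ (hw ⟨d, hd, ⟨hDd hd, rfl⟩⟩)
      exact le_sSup ⟨v, ⟨x, hxd, hv⟩, rfl⟩

/-! ### The order on states -/

section States

variable {Q V : Type*}

theorem state_le_iff [LE V] {s t : State Q V} : s ≤ t ↔ s.1 = t.1 ∧ s.2 ≤ t.2 := by
  rcases s with ⟨p, x⟩
  rcases t with ⟨q, y⟩
  constructor
  · rintro ⟨_, _, _, h⟩
    exact ⟨rfl, h⟩
  · rintro ⟨h, h'⟩
    cases h
    exact Sigma.LE.fiber _ _ _ h'

theorem state_mk_le_mk [LE V] {p : Q} {x y : V} :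
    (⟨p, x⟩ : State Q V) ≤ ⟨p, y⟩ ↔ x ≤ y := by
  simp

theorem mem_liftMap {p q : Q} {f : V →. V} {s t : State Q V} :
    t ∈ liftMap p f q s ↔ s.1 = p ∧ t.1 = q ∧ t.2 ∈ f s.2 := by
  constructor
  · rintro ⟨h, rfl⟩
    exact ⟨h.1, rfl, ⟨h.2, rfl⟩⟩
  · rcases t with ⟨q', w⟩
    rintro ⟨rfl, rfl, h, rfl⟩
    exact ⟨⟨rfl, h⟩, rfl⟩

theorem mem_liftMap_dom {p q : Q} {f : V →. V} {s : State Q V} :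
    s ∈ (liftMap p f q).Dom ↔ s.1 = p ∧ s.2 ∈ f.Dom :=
  Iff.rfl

variable [PartialOrder V]

theorem liftMap_partialMonotone {p q : Q} {f : V →. V} :
    PartialMonotone (liftMap p f q) ↔ PartialMonotone f := by
  constructor
  · rintro ⟨h1, h2⟩
    refine ⟨fun x y hxy hx => ?_, fun x y x' y' hxy hx hy => ?_⟩
    · exact (h1 (a := ⟨p, x⟩) (b := ⟨p, y⟩) (state_mk_le_mk.2 hxy) ⟨rfl, hx⟩).2
    · exact state_mk_le_mk.1 (h2 ⟨p, x⟩ ⟨p, y⟩ ⟨q, x'⟩ ⟨q, y'⟩ (state_mk_le_mk.2 hxy)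
        (mem_liftMap.2 ⟨rfl, rfl, hx⟩) (mem_liftMap.2 ⟨rfl, rfl, hy⟩))
  · rintro ⟨h1, h2⟩
    refine ⟨fun s t hst hs => ?_, fun s t s' t' hst hs ht => ?_⟩
    · obtain ⟨h, h'⟩ := state_le_iff.1 hst
      exact ⟨h ▸ hs.1, h1 h' hs.2⟩
    · obtain ⟨-, h'⟩ := state_le_iff.1 hst
      obtain ⟨-, hs1, hs2⟩ := mem_liftMap.1 hs
      obtain ⟨-, ht1, ht2⟩ := mem_liftMap.1 ht
      exact state_le_iff.2 ⟨hs1.trans ht1.symm, h2 _ _ _ _ h' hs2 ht2⟩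

/-- A non-empty directed set of states lies over a single control state. -/
theorem exists_eq_image_of_directedOn {D : Set (State Q V)} (hne : D.Nonempty)
    (hD : DirectedOn (· ≤ ·) D) :
    ∃ (p : Q) (E : Set V), E.Nonempty ∧ DirectedOn (· ≤ ·) E ∧ D = Sigma.mk p '' E := by
  obtain ⟨⟨p, x⟩, hx⟩ := hne
  have hp : ∀ s ∈ D, s.1 = p := by
    intro s hs
    obtain ⟨t, -, h1, h2⟩ := hD _ hx _ hs
    exact (state_le_iff.1 h2).1.trans (state_le_iff.1 h1).1.symm
  refine ⟨p, {v | (⟨p, v⟩ : State Q V) ∈ D}, ⟨x, hx⟩, ?_, ?_⟩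
  · intro v hv w hw
    obtain ⟨⟨q, t⟩, ht, h1, h2⟩ := hD _ hv _ hw
    obtain rfl : q = p := hp _ ht
    exact ⟨t, ht, state_mk_le_mk.1 h1, state_mk_le_mk.1 h2⟩
  · ext ⟨q, v⟩
    constructor
    · intro h
      obtain rfl : q = p := hp _ h
      exact ⟨v, h, rfl⟩
    · rintro ⟨w, hw, h⟩
      exact h ▸ hw

theorem isLUB_image_mk_iff {p : Q} {E : Set V} (hE : E.Nonempty) {s : State Q V} :
    IsLUB (Sigma.mk p '' E) s ↔ s.1 = p ∧ IsLUB E s.2 := by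
  obtain ⟨e, he⟩ := hE
  rcases s with ⟨q, z⟩
  constructor
  · intro h
    obtain rfl : p = q := (state_le_iff.1 (h.1 ⟨e, he, rfl⟩)).1
    refine ⟨rfl, fun v hv => state_mk_le_mk.1 (h.1 ⟨v, hv, rfl⟩), fun w hw => ?_⟩
    refine (state_mk_le_mk (p := p)).1 (h.2 ?_)
    rintro _ ⟨v, hv, rfl⟩
    exact state_mk_le_mk.2 (hw hv)
  · rintro ⟨h, h'⟩
    obtain rfl : q = p := h
    refine ⟨?_, ?_⟩
    · rintro _ ⟨v, hv, rfl⟩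
      exact state_mk_le_mk.2 (h'.1 hv)
    · rintro ⟨r, w⟩ hw
      obtain rfl : q = r := (state_le_iff.1 (hw ⟨e, he, rfl⟩)).1
      exact state_mk_le_mk.2 (h'.2 fun v hv => state_mk_le_mk.1 (hw ⟨v, hv, rfl⟩))

theorem liftMap_partialContinuous {p q : Q} {f : V →. V} (hf : PartialContinuous f) :
    PartialContinuous (liftMap p f q) := by
  obtain ⟨⟨hup, hin⟩, hc⟩ := hf
  refine ⟨⟨fun s t hst hs => ?_, ?_⟩, ?_⟩
  · obtain ⟨h, h'⟩ := state_le_iff.1 hst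
    exact ⟨h ▸ hs.1, hup h' hs.2⟩
  · intro D hne hD z hz hzd
    obtain ⟨r, E, hE, hEd, rfl⟩ := exists_eq_image_of_directedOn hne hD
    obtain ⟨hr, hl⟩ := (isLUB_image_mk_iff hE).1 hz
    obtain ⟨v, hv, hvd⟩ := hin hE hEd hl hzd.2
    exact ⟨⟨r, v⟩, ⟨v, hv, rfl⟩, hr ▸ hzd.1, hvd⟩
  · intro D hne hD hDd z hz
    obtain ⟨r, E, hE, hEd, rfl⟩ := exists_eq_image_of_directedOn hne hD
    obtain ⟨hr, hl⟩ := (isLUB_image_mk_iff hE).1 hz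
    have hEf : E ⊆ f.Dom := fun v hv => (hDd ⟨v, hv, rfl⟩).2
    have hrp : r = p := by
      obtain ⟨v, hv⟩ := hE
      exact (hDd ⟨v, hv, rfl⟩).1
    obtain ⟨w, hw, hwl⟩ := hc E hE hEd hEf _ hl
    refine ⟨⟨q, w⟩, mem_liftMap.2 ⟨hr.trans hrp, rfl, hw⟩, ?_⟩
    have himg : (liftMap p f q).image (Sigma.mk r '' E) = Sigma.mk q '' f.image E := by
      ext ⟨q', w'⟩
      constructor
      · rintro ⟨_, ⟨v, hv, rfl⟩, hm⟩
        obtain ⟨-, h1, h2⟩ := mem_liftMap.1 hm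
        obtain rfl : q' = q := h1
        exact ⟨w', ⟨v, hv, h2⟩, rfl⟩
      · rintro ⟨w'', ⟨v, hv, h2⟩, h⟩
        rw [← h]
        exact ⟨_, ⟨v, hv, rfl⟩, mem_liftMap.2 ⟨hrp, rfl, h2⟩⟩
    rw [himg]
    refine (isLUB_image_mk_iff ?_).2 ⟨rfl, hwl⟩
    obtain ⟨v, hv⟩ := hE
    exact ⟨_, v, hv, ⟨hEf hv, rfl⟩⟩

theorem state_wellQuasiOrderedLE [Finite Q] [WellQuasiOrderedLE V] :
    WellQuasiOrderedLE (State Q V) := by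
  refine ⟨fun u => ?_⟩
  have h := (Finite.wellQuasiOrdered (α := Q) (· = ·)).prod
    (wellQuasiOrdered_le (α := V))
  obtain ⟨i, j, hij, h1, h2⟩ := h fun k => ((u k).1, (u k).2)
  exact ⟨i, j, hij, state_le_iff.2 ⟨h1, h2⟩⟩

end States

section Continuous

variable {Q : Type*} {n : ℕ}

theorem directedOn_emb_le (y : Fin n → ℕ∞) :
    DirectedOn (· ≤ ·) (emb '' {x | emb x ≤ y}) := by
  rintro _ ⟨x, hx, rfl⟩ _ ⟨x', hx', rfl⟩
  refine ⟨emb (x ⊔ x'), ⟨_, fun k => ?_, rfl⟩, emb_le_emb.2 le_sup_left, emb_le_emb.2 le_sup_right⟩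
  rcases le_total (x k) (x' k) with h | h
  · simpa [emb, h] using hx' k
  · simpa [emb, h] using hx k

theorem isLUB_emb_le (y : Fin n → ℕ∞) : IsLUB (emb '' {x | emb x ≤ y}) y := by
  refine ⟨?_, fun w hw => le_of_forall_emb_le fun x hx => hw ⟨x, hx, rfl⟩⟩
  rintro _ ⟨x, hx, rfl⟩
  exact hx

theorem emb_zero_le (y : Fin n → ℕ∞) : emb 0 ≤ y := fun k => by simp [emb]

/-- The states below `s` in the way-below relation are those that lie below some natural
state that is itself below `s`. -/
theorem wayBelow_state_iff {s t : State Q (Fin n → ℕ∞)} :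
    WayBelow t s ↔ ∃ x : Fin n → ℕ, t ≤ ⟨s.1, emb x⟩ ∧ emb x ≤ s.2 := by
  constructor
  · intro h
    have hne : (emb '' {x | emb x ≤ s.2}).Nonempty := ⟨_, 0, emb_zero_le _, rfl⟩
    have hdir : DirectedOn (· ≤ ·)
        (Sigma.mk s.1 '' (emb '' {x | emb x ≤ s.2}) : Set (State Q (Fin n → ℕ∞))) := by
      rintro _ ⟨v, hv, rfl⟩ _ ⟨w, hw, rfl⟩
      obtain ⟨z, hz, h1, h2⟩ := directedOn_emb_le s.2 v hv w hw
      exact ⟨_, ⟨z, hz, rfl⟩, state_mk_le_mk.2 h1, state_mk_le_mk.2 h2⟩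
    obtain ⟨_, ⟨_, ⟨x, hx, rfl⟩, rfl⟩, htx⟩ := h _ (hne.image _) hdir s
      ((isLUB_image_mk_iff hne).2 ⟨rfl, isLUB_emb_le _⟩) le_rfl
    exact ⟨x, htx, hx⟩
  · rintro ⟨x, htx, hx⟩ D hne hD z hz hsz
    obtain ⟨r, E, hE, hEd, rfl⟩ := exists_eq_image_of_directedOn hne hD
    obtain ⟨hr, hl⟩ := (isLUB_image_mk_iff hE).1 hz
    obtain ⟨h1, h2⟩ := state_le_iff.1 hsz
    obtain ⟨d, hd, hxd⟩ := exists_mem_emb_le_of_directedOn hE hEd hl (hx.trans h2)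
    exact ⟨_, ⟨d, hd, rfl⟩, htx.trans (state_le_iff.2 ⟨h1.trans hr, hxd⟩)⟩

theorem isContinuousDcwo_state [Finite Q] : IsContinuousDcwo (State Q (Fin n → ℕ∞)) := by
  refine ⟨⟨fun D hne hD => ?_, fun s => ⟨⟨⟨s.1, emb 0⟩, ?_⟩, ?_, ?_, ?_⟩⟩,
    state_wellQuasiOrderedLE⟩
  · obtain ⟨r, E, hE, hEd, rfl⟩ := exists_eq_image_of_directedOn hne hD
    exact ⟨⟨r, sSup E⟩, (isLUB_image_mk_iff hE).2 ⟨rfl, isLUB_sSup E⟩⟩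
  · exact wayBelow_state_iff.2 ⟨0, le_rfl, emb_zero_le _⟩
  · intro t ht t' ht'
    obtain ⟨x, h1, h2⟩ := wayBelow_state_iff.1 ht
    obtain ⟨x', h1', h2'⟩ := wayBelow_state_iff.1 ht'
    obtain ⟨_, ⟨z, hz, rfl⟩, hxz, hxz'⟩ :=
      directedOn_emb_le s.2 _ ⟨x, h2, rfl⟩ _ ⟨x', h2', rfl⟩
    exact ⟨⟨s.1, emb z⟩, wayBelow_state_iff.2 ⟨z, le_rfl, hz⟩,
      h1.trans (state_mk_le_mk.2 hxz), h1'.trans (state_mk_le_mk.2 hxz')⟩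
  · intro t ht
    obtain ⟨x, h1, h2⟩ := wayBelow_state_iff.1 ht
    exact h1.trans (state_mk_le_mk.2 h2)
  · intro w hw
    have hx : ∀ x, emb x ≤ s.2 → (⟨s.1, emb x⟩ : State Q (Fin n → ℕ∞)) ≤ w := fun x hx =>
      hw (wayBelow_state_iff.2 ⟨x, le_rfl, hx⟩)
    exact state_le_iff.2 ⟨(state_le_iff.1 (hx 0 (emb_zero_le _))).1,
      le_of_forall_emb_le fun x h => (state_le_iff.1 (hx x h)).2⟩

end Continuous

theorem FunctionalTS.isStronglyMonotonic_of_partialMonotone {S : Type*} [PartialOrder S]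
    {T : FunctionalTS S} (h : ∀ f ∈ T.maps, PartialMonotone f) : T.IsStronglyMonotonic := by
  rintro s s' s₁ ⟨f, hf, hs⟩ hle
  have hd : s₁ ∈ f.Dom := (h f hf).1 hle (Part.dom_iff_mem.2 ⟨_, hs⟩)
  exact ⟨(f s₁).get hd, ⟨f, hf, Part.get_mem hd⟩, (h f hf).2 _ _ _ _ hle hs (Part.get_mem hd)⟩

theorem FunctionalTS.IsStronglyMonotonic.isMonotonic {S : Type*} [PartialOrder S]
    {T : FunctionalTS S} (h : T.IsStronglyMonotonic) : T.IsMonotonic := by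
  intro s s' s₁ hs hle
  obtain ⟨t, ht, hst⟩ := h s s' s₁ hs hle
  exact ⟨t, Relation.ReflTransGen.single ht, hst⟩

/-! ### Partial affine relations -/

section Affine

variable {n : ℕ} {r : CounterRel n}

theorem mem_of_mem_relFun {x y : Fin n → ℕ} (h : y ∈ relFun r x) : (x, y) ∈ r := by
  obtain ⟨h, rfl⟩ := h
  exact h.choose_spec

theorem IsPartialAffine.relFun_mono (hr : IsPartialAffine r) {x y x' y' : Fin n → ℕ}
    (hxy : x ≤ y) (hx : x' ∈ relFun r x) (hy : y' ∈ relFun r y) : x' ≤ y' := by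
  obtain ⟨-, A, b, hA⟩ := hr
  intro i
  have h1 := hA _ _ (mem_of_mem_relFun hx) i
  have h2 := hA _ _ (mem_of_mem_relFun hy) i
  have h3 : (A.mulVec x) i ≤ (A.mulVec y) i := by
    simp only [Matrix.mulVec, dotProduct]
    exact Finset.sum_le_sum fun j _ => Nat.mul_le_mul_left (A i j) (hxy j)
  change x' i ≤ y' i
  omega

end Affine

section Equivalences

variable {Q : Type*} [Finite Q] {n : ℕ} (C : AffineCounterSystem Q n)

theorem AffineCounterSystem.isStronglyMonotonicWSTS_iff :
    C.system.IsStronglyMonotonicWSTS ↔ C.UpwardClosedDomains := by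
  constructor
  · intro h t ht
    exact (liftMap_partialMonotone.1 (h.1.1 _ ⟨t, ht, rfl⟩)).1
  · intro h
    have hm : ∀ f ∈ C.system.maps, PartialMonotone f := by
      rintro _ ⟨t, ht, rfl⟩
      exact liftMap_partialMonotone.2
        ⟨h t ht, fun _ _ _ _ => (C.affine _ (C.trans_rel t ht)).relFun_mono⟩
    have hs := FunctionalTS.isStronglyMonotonic_of_partialMonotone hm
    exact ⟨⟨hm, hs.isMonotonic, state_wellQuasiOrderedLE⟩, hs⟩

theorem AffineCounterSystem.upwardClosedDomains_of_isCompleteWSTS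
    (h : C.completion.IsCompleteWSTS) : C.UpwardClosedDomains := by
  intro t ht x y hxy hx
  have hm := (liftMap_partialMonotone.1 (h.1.1 _ ⟨t, ht, rfl⟩)).1
  exact emb_mem_contExt_dom.1 (hm (emb_le_emb.2 hxy) (emb_mem_contExt_dom.2 hx))

theorem AffineCounterSystem.isCompleteWSTS_completion (h : C.UpwardClosedDomains) :
    C.completion.IsCompleteWSTS := by
  have hm : ∀ f ∈ C.completion.maps, PartialMonotone f := by
    rintro _ ⟨t, ht, rfl⟩
    exact liftMap_partialMonotone.2 (contExt_partialMonotone (h t ht))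
  refine ⟨⟨hm, (FunctionalTS.isStronglyMonotonic_of_partialMonotone hm).isMonotonic,
    state_wellQuasiOrderedLE⟩, isContinuousDcwo_state, ?_⟩
  rintro _ ⟨t, ht, rfl⟩
  exact liftMap_partialContinuous (contExt_partialContinuous (h t ht))

end Equivalences

/-! ### Primitive recursion on the coded states -/

/-- `ℕ_ω` is `Option ℕ`, with `ω` in the role of `none`. -/
def enatEquivOption : ℕ∞ ≃ Option ℕ := Equiv.refl (WithTop ℕ)

/-- `ℕ_ω` with the coding of `Option ℕ`, that is, with `omegaCode`. -/
instance primcodableENat : Primcodable ℕ∞ :=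
  Primcodable.ofEquiv (Option ℕ) enatEquivOption

theorem encode_enat (m : ℕ∞) : Encodable.encode m = omegaCode m := by
  cases m with
  | top => rfl
  | coe k => rfl

/-- The code of a vector is that of the list of the codes of its coordinates. -/
theorem encode_finArrow {α : Type*} [Primcodable α] {n : ℕ} (x : Fin n → α) :
    Primcodable.finArrow.toEncodable.encode x =
      Encodable.encode (List.ofFn fun i => Encodable.encode (x i)) := by
  have h1 : Primcodable.finArrow.toEncodable.encode x = Encodable.encode (List.ofFn x) := by
    rw [← List.Vector.toList_ofFn]
    exact Encodable.encode_ofEquiv (Equiv.vectorEquivFin α n).symm x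
  have h2 : ∀ l : List α, Encodable.encode l = Encodable.encode (l.map Encodable.encode) := by
    intro l
    induction l with
    | nil => rfl
    | cons a l ih => simp [Encodable.encode_list_cons, ih]
  rw [h1, h2, List.map_ofFn]
  rfl

section Coding

variable {Q : Type*} [Finite Q] {n : ℕ}

/-- The states as pairs of a number and a vector, by the chosen numbering of the control
states. -/
noncomputable def stateEquiv (Q : Type*) [Finite Q] (n : ℕ) :
    State Q (Fin n → ℕ∞) ≃ Fin (Nat.card Q) × (Fin n → ℕ∞) :=
  (Equiv.sigmaEquivProd _ _).trans ((Finite.equivFin Q).prodCongr (Equiv.refl _))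

/-- The states with the coding of pairs of a number and a vector. -/
noncomputable instance primcodableState : Primcodable (State Q (Fin n → ℕ∞)) :=
  Primcodable.ofEquiv _ (stateEquiv Q n)

/-- The coding of `primcodableState` is the standard one, which makes the library of primitive
recursive functions available for the standard representation. -/
theorem encode_state (s : State Q (Fin n → ℕ∞)) : Encodable.encode s = stateCode s := by
  have h : Encodable.encode s = Nat.pair (Finite.equivFin Q s.1)
      (Primcodable.finArrow.toEncodable.encode s.2) :=
    @Encodable.encode_ofEquiv _ _ Primcodable.prod.toEncodable (stateEquiv Q n) s
  rw [h, encode_finArrow, stateCode]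
  simp only [encode_enat]

theorem primrec_vec : Primrec fun s : State Q (Fin n → ℕ∞) => s.2 :=
  Primrec.snd.comp (Primrec.of_equiv (e := stateEquiv Q n))

theorem primrec_num : Primrec fun s : State Q (Fin n → ℕ∞) => Finite.equivFin Q s.1 :=
  Primrec.fst.comp (Primrec.of_equiv (e := stateEquiv Q n))

theorem primrec_coord (i : Fin n) : Primrec fun s : State Q (Fin n → ℕ∞) => s.2 i :=
  Primrec.fin_app.comp primrec_vec (Primrec.const i)

theorem primrec_vec_mk {α σ : Type*} [Primcodable α] [Primcodable σ] {f : α → Fin n → σ}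
    (h : ∀ i, Primrec fun a => f a i) : Primrec f :=
  Primrec.fin_curry.2 (Primrec.fin_curry₁ (f := fun i a => f a i).2 h).swap

theorem primrec_state_mk {α : Type*} [Primcodable α] {p : α → Q} {x : α → Fin n → ℕ∞}
    (hp : Primrec fun a => Finite.equivFin Q (p a)) (hx : ∀ i, Primrec fun a => x a i) :
    Primrec fun a => (⟨p a, x a⟩ : State Q (Fin n → ℕ∞)) := by
  have h := (Primrec.of_equiv_symm (e := stateEquiv Q n)).comp (hp.pair (primrec_vec_mk hx))
  exact h.of_eq fun a => (stateEquiv Q n).symm_apply_apply ⟨p a, x a⟩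

end Coding

theorem primrecPred_exists_mem_list {α ι : Type*} [Primcodable α] {p : ι → α → Prop}
    (h : ∀ i, PrimrecPred (p i)) (l : List ι) : PrimrecPred fun a => ∃ i ∈ l, p i a := by
  classical
  induction l with
  | nil => exact (Primrec.primrecPred (p := fun _ => False) (Primrec.const _)).of_eq (by simp)
  | cons i l ih => exact ((h i).or ih).of_eq (by simp)

theorem primrecPred_forall_fin {α : Type*} [Primcodable α] {n : ℕ} {p : Fin n → α → Prop}
    (h : ∀ i, PrimrecPred (p i)) : PrimrecPred fun a => ∀ i, p i a :=
  (primrecPred_exists_mem_list (fun i => (h i).not) (List.finRange n)).not.of_eq (by simp)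

theorem primrecRel_enat_le : PrimrecRel ((· ≤ ·) : ℕ∞ → ℕ∞ → Prop) := by
  classical
  -- `ω` has the code `0`, and the codes of natural numbers are ordered like these
  have h : PrimrecPred fun q : ℕ∞ × ℕ∞ => Encodable.encode q.2 = 0 ∨
      (Encodable.encode q.1 ≠ 0 ∧ Encodable.encode q.1 ≤ Encodable.encode q.2) := by
    have e1 : Primrec fun q : ℕ∞ × ℕ∞ => Encodable.encode q.1 := Primrec.encode.comp Primrec.fst
    have e2 : Primrec fun q : ℕ∞ × ℕ∞ => Encodable.encode q.2 := Primrec.encode.comp Primrec.snd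
    exact (Primrec.eq.comp e2 (Primrec.const 0)).or
      ((Primrec.eq.comp e1 (Primrec.const 0)).not.and (Primrec.nat_le.comp e1 e2))
  refine h.of_eq ?_
  rintro ⟨a, b⟩
  cases a <;> cases b <;> simp [encode_enat, omegaCode]

theorem primrec_enatEquivOption : Primrec enatEquivOption :=
  Primrec.of_equiv (α := Option ℕ)

theorem primrec_enatEquivOption_symm : Primrec enatEquivOption.symm :=
  Primrec.of_equiv_symm (α := Option ℕ)

/-- A primitive recursive map of natural numbers stays so when extended by `ω ↦ ω`. -/
theorem primrec_enat_map {f : ℕ → ℕ} (hf : Primrec f) {g : ℕ∞ → ℕ∞}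
    (hg : ∀ a : ℕ, g a = f a) (ht : g ⊤ = ⊤) : Primrec g := by
  refine (primrec_enatEquivOption_symm.comp
    ((Primrec.option_map₁ hf).comp primrec_enatEquivOption)).of_eq fun a => ?_
  cases a with
  | top => exact ht.symm
  | coe a => exact (hg a).symm

theorem primrec_enat_add : Primrec₂ ((· + ·) : ℕ∞ → ℕ∞ → ℕ∞) := by
  have h : Primrec fun q : ℕ∞ × ℕ∞ =>
      (enatEquivOption q.1).bind fun a => (enatEquivOption q.2).map fun b => a + b := by
    refine Primrec.option_bind (primrec_enatEquivOption.comp Primrec.fst) ?_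
    refine Primrec.option_map
      (primrec_enatEquivOption.comp (Primrec.snd.comp Primrec.fst)) ?_
    exact Primrec.nat_add.comp (Primrec.snd.comp Primrec.fst) Primrec.snd
  refine (primrec_enatEquivOption_symm.comp h).of_eq ?_
  rintro ⟨a, b⟩
  cases a <;> cases b <;> rfl

theorem primrec_enat_mul_const (c : ℕ) : Primrec fun m : ℕ∞ => (c : ℕ∞) * m := by
  rcases Nat.eq_zero_or_pos c with rfl | hc
  · simpa using Primrec.const (0 : ℕ∞)
  · exact primrec_enat_map (Primrec.nat_mul.comp (Primrec.const c) Primrec.id)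
      (fun a => (Nat.cast_mul c a).symm) (ENat.mul_top (by exact_mod_cast hc.ne'))

theorem primrec_enat_sub_const (c : ℕ) : Primrec fun m : ℕ∞ => m - (c : ℕ∞) :=
  primrec_enat_map (Primrec.nat_sub.comp Primrec.id (Primrec.const c))
    (fun a => (ENat.natCast_sub a c).symm) (ENat.top_sub_natCast c)

theorem primrec_enat_sum {α ι : Type*} [Primcodable α] (s : Finset ι) {f : ι → α → ℕ∞}
    (h : ∀ i, Primrec (f i)) : Primrec fun a => ∑ i ∈ s, f i a := by
  classical
  induction s using Finset.induction_on with
  | empty => simpa using Primrec.const (0 : ℕ∞)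
  | insert i s hi ih => simpa [Finset.sum_insert hi] using primrec_enat_add.comp (h i) ih

theorem primrec_iterate_const {α : Type*} [Primcodable α] {f : α → α} (h : Primrec f) (m : ℕ) :
    Primrec f^[m] := by
  induction m with
  | zero => exact Primrec.id
  | succ m ih => exact ih.comp h

section Coding

variable {Q : Type*} [Finite Q] {n : ℕ}

theorem primrecRel_state_le :
    PrimrecRel ((· ≤ ·) : State Q (Fin n → ℕ∞) → State Q (Fin n → ℕ∞) → Prop) := by
  have h1 : PrimrecPred fun q : State Q (Fin n → ℕ∞) × State Q (Fin n → ℕ∞) =>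
      Finite.equivFin Q q.1.1 = Finite.equivFin Q q.2.1 :=
    Primrec.eq.comp (primrec_num.comp Primrec.fst) (primrec_num.comp Primrec.snd)
  have h2 : PrimrecPred fun q : State Q (Fin n → ℕ∞) × State Q (Fin n → ℕ∞) =>
      ∀ i, q.1.2 i ≤ q.2.2 i :=
    primrecPred_forall_fin fun i => primrecRel_enat_le.comp
      ((primrec_coord i).comp Primrec.fst) ((primrec_coord i).comp Primrec.snd)
  exact (h1.and h2).of_eq fun q => by simp [state_le_iff, Pi.le_def]

theorem stdRep_toState_encode (e : (stdRep Q n).codes) :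
    Encodable.encode ((stdRep Q n).toState e) = (e : ℕ) := by
  rw [encode_state]
  exact congrArg Subtype.val ((Equiv.ofInjective _ stateCode_injective).apply_symm_apply e)

theorem stdRep_exists_code (s : State Q (Fin n → ℕ∞)) :
    ∃ e : (stdRep Q n).codes, (e : ℕ) = Encodable.encode s ∧ (stdRep Q n).toState e = s := by
  obtain ⟨e, rfl⟩ := (stdRep Q n).surjective s
  exact ⟨e, (stdRep_toState_encode e).symm, rfl⟩

theorem stdRep_decode (e : (stdRep Q n).codes) :
    Encodable.decode (e : ℕ) = some ((stdRep Q n).toState e) := by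
  rw [← stdRep_toState_encode e, Encodable.encodek]

theorem stdRep_decidableOrder : (stdRep Q n).DecidableOrder := by
  classical
  let φ : ℕ × ℕ → Bool := fun q =>
    ((Encodable.decode q.1 : Option (State Q (Fin n → ℕ∞))).bind fun s =>
      (Encodable.decode q.2 : Option (State Q (Fin n → ℕ∞))).map fun t =>
        decide (s ≤ t)).getD false
  have hφ : Primrec φ := by
    refine Primrec.option_getD.comp (Primrec.option_bind (Primrec.decode.comp Primrec.fst)
      (Primrec.option_map (Primrec.decode.comp (Primrec.snd.comp Primrec.fst)) ?_))
      (Primrec.const false)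
    exact primrecRel_state_le.decide.comp (Primrec.snd.comp Primrec.fst) Primrec.snd
  refine ⟨φ, hφ.to_comp.partrec, fun e e' => ⟨φ (e, e'), Part.mem_some _, ?_⟩⟩
  simp [φ, stdRep_decode]

/-- The partial map `f` is decided and computed by the primitive recursive function `F`. -/
def PrimrecMap (f : State Q (Fin n → ℕ∞) →. State Q (Fin n → ℕ∞)) : Prop :=
  ∃ F : State Q (Fin n → ℕ∞) → Option (State Q (Fin n → ℕ∞)),
    Primrec F ∧ ∀ s t, t ∈ f s ↔ F s = some t

theorem PrimrecMap.computableMap {f : State Q (Fin n → ℕ∞) →. State Q (Fin n → ℕ∞)}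
    (hf : PrimrecMap f) : (stdRep Q n).ComputableMap f := by
  obtain ⟨F, hF, hfF⟩ := hf
  let φ : ℕ → Option ℕ := fun e =>
    ((Encodable.decode e : Option (State Q (Fin n → ℕ∞))).bind F).map Encodable.encode
  have hφ : Primrec φ :=
    (Primrec.option_map₁ Primrec.encode).comp ((Primrec.option_bind₁ hF).comp Primrec.decode)
  refine ⟨φ, hφ.to_comp.partrec, fun e => ⟨fun hd => ?_, fun hd => ?_⟩⟩
  · obtain ⟨t, ht⟩ := Part.dom_iff_mem.1 hd
    obtain ⟨e', he', rfl⟩ := stdRep_exists_code t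
    refine ⟨e', Part.mem_some_iff.2 ?_, ht⟩
    simp [φ, stdRep_decode, (hfF _ _).1 ht, he']
  · have hn : F ((stdRep Q n).toState e) = none := by
      refine Option.eq_none_iff_forall_ne_some.2 fun t ht => hd (Part.dom_iff_mem.2 ⟨t, ?_⟩)
      exact (hfF _ _).2 ht
    refine Part.mem_some_iff.2 ?_
    simp [φ, stdRep_decode, hn]

theorem PrimrecMap.id : PrimrecMap (PFun.id (State Q (Fin n → ℕ∞))) :=
  ⟨some, Primrec.option_some, fun s t => by simp [PFun.id, eq_comm]⟩

theorem PrimrecMap.comp {f g : State Q (Fin n → ℕ∞) →. State Q (Fin n → ℕ∞)}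
    (hf : PrimrecMap f) (hg : PrimrecMap g) : PrimrecMap (f.comp g) := by
  obtain ⟨F, hF, hfF⟩ := hf
  obtain ⟨G, hG, hgG⟩ := hg
  refine ⟨fun s => (G s).bind F, Primrec.option_bind hG (hF.comp Primrec.snd), fun s t => ?_⟩
  rw [PFun.comp_apply]
  refine Part.mem_bind_iff.trans ?_
  rw [Option.bind_eq_some_iff]
  simp only [hfF, hgG]

end Coding

/-! ### Limits of increasing orbits -/

/-- Let `x` be an increasing sequence of vectors in which the coordinates that are `ω`, and those
that are strictly increased, are determined at each step by those of the step before, through the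
dependency relation `D`. Then the supremum can be read off from the members of index `4 ^ n` and
`2 * 4 ^ n`: a coordinate that changes between these two indices goes on changing for ever, and a
coordinate that does not is constant from there on. -/
theorem isLUB_range_of_dependency {n : ℕ} {D : Fin n → Fin n → Prop} {x : ℕ → Fin n → ℕ∞}
    (hx : Monotone x) (htop : ∀ m i, x (m + 1) i = ⊤ ↔ ∃ j, D i j ∧ x m j = ⊤)
    (hlt : ∀ m i, x (m + 1) i < x (m + 2) i ↔
      x (m + 1) i ≠ ⊤ ∧ ∃ j, D i j ∧ x m j < x (m + 1) j) :
    IsLUB (Set.range x)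
      fun i => if x (4 ^ n) i = x (2 * 4 ^ n) i then x (4 ^ n) i else ⊤ := by
  classical
  let c : ℕ → Fin n → Prop × Prop := fun m i => (x m i = ⊤, x m i < x (m + 1) i)
  have hc : ∀ m m', c m = c m' → c (m + 1) = c (m' + 1) := by
    intro m m' h
    have h1 : ∀ j, x m j = ⊤ ↔ x m' j = ⊤ := fun j =>
      iff_of_eq (congrArg Prod.fst (congrFun h j))
    have h2 : ∀ j, x m j < x (m + 1) j ↔ x m' j < x (m' + 1) j := fun j =>
      iff_of_eq (congrArg Prod.snd (congrFun h j))
    funext i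
    refine Prod.ext (propext ?_) (propext ?_)
    · change x (m + 1) i = ⊤ ↔ x (m' + 1) i = ⊤
      simp only [htop, h1]
    · change x (m + 1) i < x (m + 2) i ↔ x (m' + 1) i < x (m' + 2) i
      simp only [hlt, Ne, htop, h1, h2]
  -- the `4 ^ n + 1` first values of `c` cannot be distinct
  obtain ⟨a, p, hp, hap, hper⟩ :
      ∃ a p, 0 < p ∧ a + p ≤ 4 ^ n ∧ ∀ m, a ≤ m → c (m + p) = c m := by
    have hcard : Fintype.card (Fin n → Prop × Prop) < Fintype.card (Fin (4 ^ n + 1)) := by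
      simp
    obtain ⟨k, l, hkl, he⟩ :=
      Fintype.exists_ne_map_eq_of_card_lt (fun k : Fin (4 ^ n + 1) => c k) hcard
    have hkl' : (k : ℕ) ≠ l := fun h => hkl (Fin.ext h)
    have main : ∀ a b : ℕ, a < b → b ≤ 4 ^ n → c a = c b →
        ∃ a p, 0 < p ∧ a + p ≤ 4 ^ n ∧ ∀ m, a ≤ m → c (m + p) = c m := by
      intro a b hab hb h
      refine ⟨a, b - a, by omega, by omega, fun m hm => ?_⟩
      induction m, hm using Nat.le_induction with
      | base => rw [Nat.add_sub_cancel' hab.le, h]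
      | succ m _ ih => rw [Nat.add_right_comm]; exact hc _ _ ih
    rcases lt_or_gt_of_ne hkl' with h | h
    · exact main k l h (by omega) he
    · exact main l k h (by omega) he.symm
  have hper' : ∀ m i, a ≤ m → (x (m + p) i < x (m + p + 1) i ↔ x m i < x (m + 1) i) :=
    fun m i hm => iff_of_eq (congrArg Prod.snd (congrFun (hper m hm) i))
  set N := 4 ^ n with hN
  refine isLUB_pi.2 fun i => ?_
  rw [← Set.range_comp]
  change IsLUB (Set.range fun m => x m i) _
  have hmono : Monotone fun m => x m i := fun m m' h => hx h i
  by_cases heq : x N i = x (2 * N) i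
  · simp only [heq, if_true]
    have hstep : ∀ m, N ≤ m → ¬ x m i < x (m + 1) i := by
      intro m
      induction m using Nat.strong_induction_on with
      | _ m ih =>
        intro hm
        by_cases h2 : m < 2 * N
        · rw [not_lt]
          calc x (m + 1) i ≤ x (2 * N) i := hmono (by omega)
            _ = x N i := heq.symm
            _ ≤ x m i := hmono hm
        · have h3 := hper' (m - p) i (by omega)
          rw [Nat.sub_add_cancel (by omega)] at h3
          rw [h3]
          exact ih (m - p) (by omega) (by omega)
    have hconst : ∀ m, N ≤ m → x m i ≤ x N i := by
      intro m hm
      induction m, hm using Nat.le_induction with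
      | base => exact le_rfl
      | succ m hm ih => exact (not_lt.1 (hstep m hm)).trans ih
    refine ⟨?_, fun w hw => hw ⟨2 * N, rfl⟩⟩
    rintro _ ⟨m, rfl⟩
    rcases le_total m N with h | h
    · exact (hmono h).trans heq.le
    · exact (hconst m h).trans heq.le
  · simp only [heq, if_false]
    obtain ⟨m, hm, hchange⟩ : ∃ m, N ≤ m ∧ x m i < x (m + 1) i := by
      by_contra! hcon
      refine heq (le_antisymm (hmono (by omega)) ?_)
      have : ∀ m, N ≤ m → x m i ≤ x N i := by
        intro m hm
        induction m, hm using Nat.le_induction with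
        | base => exact le_rfl
        | succ m hm ih => exact (hcon m hm).trans ih
      exact this _ (by omega)
    have hall : ∀ k, x (m + k * p) i < x (m + k * p + 1) i := by
      intro k
      induction k with
      | zero => simpa using hchange
      | succ k ih =>
        have := (hper' (m + k * p) i (by omega)).2 ih
        rwa [show m + (k + 1) * p = m + k * p + p by ring]
    have hgrow : ∀ k : ℕ, (k : ℕ∞) ≤ x (m + k * p) i := by
      intro k
      induction k with
      | zero => simp
      | succ k ih =>
        calc ((k + 1 : ℕ) : ℕ∞) = (k : ℕ∞) + 1 := by push_cast; rfl
          _ ≤ x (m + k * p) i + 1 := by gcongr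
          _ ≤ x (m + k * p + 1) i := Order.add_one_le_of_lt (hall k)
          _ ≤ x (m + (k + 1) * p) i := hmono (by rw [Nat.succ_mul]; omega)
    refine ⟨fun _ _ => le_top, fun w hw => ?_⟩
    refine ENat.forall_natCast_le_iff_le.1 fun k _ => (hgrow k).trans (hw ⟨_, rfl⟩)

/-! ### Accelerations -/

section Accel

variable {Q : Type*} {n : ℕ}

/-- The values of `g` depend on the coordinates of its arguments through `D`: coordinate `i` of
`g s` is `ω` when some coordinate `j` of `s` with `D i j` is, and, if finite, increases strictly
when some coordinate `j` of `s` with `D i j` does. -/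
structure HasDependency (g : State Q (Fin n → ℕ∞) →. State Q (Fin n → ℕ∞))
    (D : Fin n → Fin n → Prop) : Prop where
  eq_top_iff : ∀ {s s'}, s' ∈ g s → ∀ i, s'.2 i = ⊤ ↔ ∃ j, D i j ∧ s.2 j = ⊤
  lt_iff : ∀ {s t s' t'}, s ≤ t → s' ∈ g s → t' ∈ g t →
    ∀ i, s'.2 i < t'.2 i ↔ s'.2 i ≠ ⊤ ∧ ∃ j, D i j ∧ s.2 j < t.2 j

theorem mem_comp_iff {S : Type*} {f g : S →. S} {s u : S} :
    u ∈ f.comp g s ↔ ∃ t ∈ g s, u ∈ f t := by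
  rw [PFun.comp_apply]
  exact Part.mem_bind_iff

theorem mem_pfun_id_iff {S : Type*} {s t : S} : t ∈ PFun.id S s ↔ t = s := by
  simp [PFun.id]

theorem HasDependency.id :
    HasDependency (PFun.id (State Q (Fin n → ℕ∞))) (fun i j => i = j) := by
  refine ⟨fun h i => ?_, fun h hs ht i => ?_⟩
  · rw [mem_pfun_id_iff] at h
    simp [h]
  · rw [mem_pfun_id_iff] at hs ht
    subst hs ht
    simp only [exists_eq_left', iff_and_self]
    exact fun h => h.ne_top

theorem PartialMonotone.comp {S : Type*} [PartialOrder S] {f g : S →. S}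
    (hf : PartialMonotone f) (hg : PartialMonotone g) : PartialMonotone (f.comp g) := by
  refine ⟨fun s t hst hs => ?_, fun s t s' t' hst hs ht => ?_⟩
  · obtain ⟨u, hu⟩ := Part.dom_iff_mem.1 hs
    obtain ⟨v, hv, hu⟩ := mem_comp_iff.1 hu
    obtain ⟨v', hv'⟩ := Part.dom_iff_mem.1 (hg.1 hst (Part.dom_iff_mem.2 ⟨v, hv⟩))
    obtain ⟨u', hu'⟩ := Part.dom_iff_mem.1
      (hf.1 (hg.2 _ _ _ _ hst hv hv') (Part.dom_iff_mem.2 ⟨u, hu⟩))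
    exact Part.dom_iff_mem.2 ⟨u', mem_comp_iff.2 ⟨v', hv', hu'⟩⟩
  · obtain ⟨v, hv, hu⟩ := mem_comp_iff.1 hs
    obtain ⟨v', hv', hu'⟩ := mem_comp_iff.1 ht
    exact hf.2 _ _ _ _ (hg.2 _ _ _ _ hst hv hv') hu hu'

theorem HasDependency.comp {f g : State Q (Fin n → ℕ∞) →. State Q (Fin n → ℕ∞)}
    {D E : Fin n → Fin n → Prop} (hf : HasDependency f D) (hg : HasDependency g E)
    (hm : PartialMonotone g) :
    HasDependency (f.comp g) (fun i k => ∃ j, D i j ∧ E j k) := by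
  refine ⟨fun h i => ?_, fun hst hs ht i => ?_⟩
  · obtain ⟨v, hv, hu⟩ := mem_comp_iff.1 h
    rw [hf.eq_top_iff hu]
    simp only [hg.eq_top_iff hv]
    tauto
  · obtain ⟨v, hv, hu⟩ := mem_comp_iff.1 hs
    obtain ⟨v', hv', hu'⟩ := mem_comp_iff.1 ht
    rw [hf.lt_iff (hm.2 _ _ _ _ hst hv hv') hu hu']
    refine and_congr_right fun hne => ?_
    -- a coordinate of `v` on which a finite coordinate of `u` depends is itself finite
    have hfin : ∀ j, D i j → v.2 j ≠ ⊤ := fun j hD htop =>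
      hne ((hf.eq_top_iff hu i).2 ⟨j, hD, htop⟩)
    simp only [hg.lt_iff hst hv hv']
    constructor
    · rintro ⟨j, hD, -, k, hE, hlt⟩
      exact ⟨k, ⟨j, hD, hE⟩, hlt⟩
    · rintro ⟨k, ⟨j, hD, hE⟩, hlt⟩
      exact ⟨j, hD, hfin j hD, k, hE, hlt⟩

/-- Along the orbit of a state that is increased by a partial monotonic map, all iterates are
defined and they form an increasing sequence. -/
theorem exists_orbit {S : Type*} [PartialOrder S] {g : S →. S} (hm : PartialMonotone g) {s t : S}
    (ht : t ∈ g s) (hst : s ≤ t) :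
    ∃ u : ℕ → S, u 0 = s ∧ Monotone u ∧ ∀ m, u (m + 1) ∈ g (u m) := by
  classical
  let G : {v : S // ∃ w ∈ g v, v ≤ w} → {v : S // ∃ w ∈ g v, v ≤ w} := fun v =>
    ⟨v.2.choose, by
      obtain ⟨hw, hvw⟩ := v.2.choose_spec
      obtain ⟨w', hw'⟩ := Part.dom_iff_mem.1 (hm.1 hvw (Part.dom_iff_mem.2 ⟨_, hw⟩))
      exact ⟨w', hw', hm.2 _ _ _ _ hvw hw hw'⟩⟩
  refine ⟨fun m => (G^[m] ⟨s, t, ht, hst⟩).1, rfl, monotone_nat_of_le_succ fun m => ?_,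
    fun m => ?_⟩
  · rw [Function.iterate_succ_apply']
    exact (G^[m] ⟨s, t, ht, hst⟩).2.choose_spec.2
  · change (G^[m + 1] ⟨s, t, ht, hst⟩).1 ∈ g _
    rw [Function.iterate_succ_apply']
    exact (G^[m] ⟨s, t, ht, hst⟩).2.choose_spec.1

theorem mem_iter_iff {S : Type*} [PartialOrder S] {g : S →. S} {u : ℕ → S}
    (hu : ∀ m, u (m + 1) ∈ g (u m)) {m : ℕ} {y : S} : y ∈ iter g m (u 0) ↔ y = u m := by
  induction m generalizing y with
  | zero => exact mem_pfun_id_iff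
  | succ m ih =>
    refine mem_comp_iff.trans ⟨?_, ?_⟩
    · rintro ⟨t, ht, hy⟩
      rw [ih.1 ht] at hy
      exact Part.mem_unique hy (hu m)
    · rintro rfl
      exact ⟨u m, ih.2 rfl, hu m⟩

theorem mem_accel_iff {S : Type*} [PartialOrder S] {g : S →. S} {s t z w : S} (ht : t ∈ g s)
    (hz : s < t → IsLUB {y | ∃ m : ℕ, y ∈ iter g m s} z) :
    w ∈ accel g s ↔ (s < t ∧ w = z) ∨ (¬ s < t ∧ w = t) := by
  classical
  obtain ⟨hd, rfl⟩ := ht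
  have hmem : w ∈ accel g s ↔ (accel g s).get hd = w :=
    ⟨fun ⟨_, h⟩ => h, fun h => ⟨hd, h⟩⟩
  rw [hmem]
  change (if s < (g s).get hd then
      if hs : ∃ z, IsLUB {y | ∃ m : ℕ, y ∈ iter g m s} z then hs.choose else s
    else (g s).get hd) = w ↔ _
  by_cases hlt : s < (g s).get hd
  · have hex : ∃ z, IsLUB {y | ∃ m : ℕ, y ∈ iter g m s} z := ⟨z, hz hlt⟩
    have hch : hex.choose = z := hex.choose_spec.unique (hz hlt)
    simp [hlt, hex, hch, eq_comm]
  · simp [hlt, eq_comm]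

variable [Finite Q]

/-- The acceleration is computed by means of two iterates of bounded order. -/
theorem PrimrecMap.accel {g : State Q (Fin n → ℕ∞) →. State Q (Fin n → ℕ∞)}
    (hg : PrimrecMap g) (hm : PartialMonotone g) {D : Fin n → Fin n → Prop}
    (hD : HasDependency g D) : PrimrecMap (accel g) := by
  classical
  obtain ⟨G, hG, hgG⟩ := hg
  let H : State Q (Fin n → ℕ∞) → State Q (Fin n → ℕ∞) := fun s => (G s).getD s
  have hH : Primrec H := Primrec.option_getD.comp hG Primrec.id
  let L : State Q (Fin n → ℕ∞) → State Q (Fin n → ℕ∞) := fun s =>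
    ⟨s.1, fun i => if (H^[4 ^ n] s).2 i = (H^[2 * 4 ^ n] s).2 i then (H^[4 ^ n] s).2 i else ⊤⟩
  have hL : Primrec L := by
    refine primrec_state_mk primrec_num fun i => ?_
    have h1 := (primrec_coord (Q := Q) i).comp (primrec_iterate_const hH (4 ^ n))
    have h2 := (primrec_coord (Q := Q) i).comp (primrec_iterate_const hH (2 * 4 ^ n))
    exact Primrec.ite (Primrec.eq.comp h1 h2) h1 (Primrec.const ⊤)
  have hLlub : ∀ s t, t ∈ g s → s < t → IsLUB {y | ∃ m : ℕ, y ∈ iter g m s} (L s) := by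
    intro s t ht hst
    obtain ⟨u, rfl, hu, hstep⟩ := exists_orbit hm ht hst.le
    have hHu : ∀ m, H^[m] (u 0) = u m := by
      intro m
      induction m with
      | zero => rfl
      | succ m ih =>
        rw [Function.iterate_succ_apply', ih]
        simp [H, (hgG _ _).1 (hstep m)]
    have h1 : ∀ m, (u m).1 = (u 0).1 := fun m => (state_le_iff.1 (hu (Nat.zero_le m))).1.symm
    have hset : {y | ∃ m : ℕ, y ∈ iter g m (u 0)} =
        Sigma.mk (u 0).1 '' Set.range fun m => (u m).2 := by
      ext y
      simp only [mem_iter_iff hstep, Set.mem_ofPred_eq, ← Set.range_comp, Set.mem_range]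
      refine exists_congr fun m => ?_
      rw [eq_comm]
      refine Eq.congr ?_ rfl
      change u m = ⟨(u 0).1, (u m).2⟩
      rw [← h1 m]
    rw [hset]
    refine (isLUB_image_mk_iff (Set.range_nonempty _)).2 ⟨rfl, ?_⟩
    simp only [L, hHu]
    exact isLUB_range_of_dependency (D := D) (fun m m' h => (state_le_iff.1 (hu h)).2)
      (fun m => hD.eq_top_iff (hstep m))
      (fun m => hD.lt_iff (hu (Nat.le_succ m)) (hstep m) (hstep (m + 1)))
  refine ⟨fun s => (G s).map fun t => if s ≤ t ∧ ¬ t ≤ s then L s else t, ?_, fun s w => ?_⟩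
  · refine Primrec.option_map hG (Primrec.ite ?_ (hL.comp Primrec.fst) Primrec.snd)
    exact (primrecRel_state_le.comp Primrec.fst Primrec.snd).and
      (primrecRel_state_le.comp Primrec.snd Primrec.fst).not
  · change _ ↔ (G s).map (fun t => if s ≤ t ∧ ¬ t ≤ s then L s else t) = some w
    cases hGs : G s with
    | none =>
      have hd : ¬ (g s).Dom := by
        intro hd
        have := (hgG _ _).1 (Part.get_mem hd)
        rw [hGs] at this
        cases this
      simp only [Option.map_none, reduceCtorEq, iff_false]
      exact fun h => hd (Part.dom_iff_mem.2 ⟨w, h⟩ : (CounterSystems.accel g s).Dom)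
    | some t =>
      have ht : t ∈ g s := (hgG _ _).2 hGs
      rw [mem_accel_iff ht (hLlub s t ht)]
      by_cases hst : s < t
      · have hst' := lt_iff_le_not_ge.1 hst
        simp only [hst, not_true, false_and, or_false, true_and, Option.map_some, if_pos hst',
          Option.some.injEq, eq_comm]
      · have hst' := fun h => hst (lt_iff_le_not_ge.2 h)
        simp only [hst, if_neg hst', Option.map_some, Option.some.injEq, false_and, false_or,
          not_false_eq_true, true_and, eq_comm]

end Accel

/-! ### Affine maps on `ℕ_ω ^ n` -/

section Affine

variable {n : ℕ} {r : CounterRel n}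

/-- The linear map of a matrix of natural numbers on `ℕ_ω ^ n`, with `0 * ω = 0`. -/
def extMulVec (A : Matrix (Fin n) (Fin n) ℕ) (y : Fin n → ℕ∞) (i : Fin n) : ℕ∞ :=
  ∑ j, (A i j : ℕ∞) * y j

theorem extMulVec_emb (A : Matrix (Fin n) (Fin n) ℕ) (x : Fin n → ℕ) (i : Fin n) :
    extMulVec A (emb x) i = ((A.mulVec x) i : ℕ) := by
  simp [extMulVec, emb, Matrix.mulVec, dotProduct]

theorem extMulVec_mono (A : Matrix (Fin n) (Fin n) ℕ) {y z : Fin n → ℕ∞} (h : y ≤ z)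
    (i : Fin n) : extMulVec A y i ≤ extMulVec A z i :=
  Finset.sum_le_sum fun j _ => mul_le_mul_right (h j) _

theorem extMulVec_eq_top_iff (A : Matrix (Fin n) (Fin n) ℕ) (y : Fin n → ℕ∞) (i : Fin n) :
    extMulVec A y i = ⊤ ↔ ∃ j, A i j ≠ 0 ∧ y j = ⊤ := by
  refine (WithTop.sum_eq_top (M := ℕ)).trans ?_
  simp only [Finset.mem_univ, true_and]
  refine exists_congr fun j => ?_
  change (A i j : ℕ∞) * y j = ⊤ ↔ _
  rcases eq_or_ne (A i j) 0 with h | h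
  · simp [h]
  · have hc : (A i j : ℕ∞) ≠ 0 := by exact_mod_cast h
    by_cases hy : y j = ⊤
    · simp [h, hy, ENat.mul_top hc]
    · obtain ⟨m, hm⟩ := ENat.ne_top_iff_exists.1 hy
      simp only [← hm, ← Nat.cast_mul, ENat.natCast_ne_top, and_false]

theorem extMulVec_lt_iff (A : Matrix (Fin n) (Fin n) ℕ) {y z : Fin n → ℕ∞} (h : y ≤ z)
    (i : Fin n) : extMulVec A y i < extMulVec A z i ↔
      extMulVec A y i ≠ ⊤ ∧ ∃ j, A i j ≠ 0 ∧ y j < z j := by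
  constructor
  · intro hlt
    refine ⟨hlt.ne_top, ?_⟩
    by_contra! hcon
    refine hlt.not_ge (Finset.sum_le_sum fun j _ => ?_)
    by_cases hj : A i j = 0
    · simp [hj]
    · exact mul_le_mul_right (hcon j hj) _
  · rintro ⟨hne, j, hj, hlt⟩
    have hle : ∀ k, (A i k : ℕ∞) * y k ≤ (A i k : ℕ∞) * z k := fun k => mul_le_mul_right (h k) _
    have hsplit : ∀ w : Fin n → ℕ∞, extMulVec A w i =
        (A i j : ℕ∞) * w j + ∑ k ∈ Finset.univ.erase j, (A i k : ℕ∞) * w k := fun w =>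
      (Finset.add_sum_erase _ _ (Finset.mem_univ j)).symm
    rw [hsplit y] at hne
    rw [hsplit y, hsplit z]
    refine ENat.add_lt_add_of_lt_of_le (fun h' => hne (by rw [h', add_top])) ?_
      (Finset.sum_le_sum fun k _ => hle k)
    have hc : (A i j : ℕ∞) ≠ 0 := by exact_mod_cast hj
    exact (ENat.mul_right_strictMono hc (ENat.natCast_ne_top _)) hlt

/-- On the domain of the extension, `f(y) + b⁻ = A y + b⁺`, where `b = b⁺ - b⁻`. -/
theorem contExt_relFun_add {A : Matrix (Fin n) (Fin n) ℕ} {b : Fin n → ℤ}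
    (hA : ∀ x y, (x, y) ∈ r → ∀ i, (y i : ℤ) = ((A.mulVec x) i : ℤ) + b i)
    (hup : IsUpperSet (relFun r).Dom) {y z : Fin n → ℕ∞} (hz : z ∈ contExt (relFun r) y)
    (i : Fin n) :
    z i + ((-b i).toNat : ℕ) = extMulVec A y i + ((b i).toNat : ℕ) := by
  have hA' : ∀ x v, v ∈ relFun r x → ∀ i,
      (v i : ℕ∞) + ((-b i).toNat : ℕ) = extMulVec A (emb x) i + ((b i).toNat : ℕ) := by
    intro x v hv i
    have h := hA x v (mem_of_mem_relFun hv) i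
    rw [extMulVec_emb]
    have h' : v i + (-b i).toNat = (A.mulVec x) i + (b i).toNat := by omega
    exact_mod_cast h'
  have hyd : y ∈ (contExt (relFun r)).Dom := Part.dom_iff_mem.2 ⟨z, hz⟩
  have hzs := eq_sSup_of_mem_contExt hz
  rw [contExt_dom_of_isUpperSet _ hup] at hyd
  obtain ⟨x₀, hx₀, hxy⟩ := hyd
  have hne : (emb '' (relFun r).image {x | emb x ≤ y}).Nonempty :=
    ⟨_, _, ⟨x₀, hxy, Part.get_mem hx₀⟩, rfl⟩
  have hlub : IsLUB ((fun v : Fin n → ℕ∞ => v i) '' (emb '' (relFun r).image {x | emb x ≤ y}))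
      (z i) := by
    rw [hzs]
    exact isLUB_pi.1 (isLUB_sSup _) i
  have hle : ∀ x, x ∈ (relFun r).Dom → emb x ≤ y →
      extMulVec A (emb x) i + ((b i).toNat : ℕ) ≤ z i + ((-b i).toNat : ℕ) := by
    intro x hx hxy
    rw [← hA' x _ (Part.get_mem hx) i]
    exact add_le_add_left (hlub.1 ⟨_, ⟨_, ⟨x, hxy, Part.get_mem hx⟩, rfl⟩, rfl⟩) _
  -- the value at `y` is approximated by those at the vectors `a m` of the domain, in which `ω`
  -- is replaced by large numbers
  let a : ℕ → Fin n → ℕ := fun m k => if y k = ⊤ then max (x₀ k) m else (y k).toNat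
  have hay : ∀ m, emb (a m) ≤ y := by
    intro m k
    by_cases hk : y k = ⊤
    · simp [hk]
    · simp [emb, a, hk, ENat.natCast_toNat hk]
  have had : ∀ m, a m ∈ (relFun r).Dom := by
    intro m
    refine hup (fun k => ?_) hx₀
    by_cases hk : y k = ⊤
    · simp [a, hk]
    · have h := hxy k
      simp only [a, hk, if_false]
      rw [← ENat.natCast_toNat hk] at h
      exact Nat.cast_le.1 h
  refine le_antisymm ?_ ?_
  -- if `A y` is finite in coordinate `i`, so is the supremum, with a bound from monotonicity
  · by_cases htop : extMulVec A y i = ⊤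
    · simp [htop]
    obtain ⟨m, hm⟩ := ENat.ne_top_iff_exists.1 htop
    rw [← hm]
    have hzle : z i ≤ ((m + (b i).toNat - (-b i).toNat : ℕ) : ℕ∞) := by
      refine hlub.2 ?_
      rintro _ ⟨_, ⟨v, ⟨x, hx, hv⟩, rfl⟩, rfl⟩
      have h1 := hA' x v hv i
      have h2 := extMulVec_mono A hx i
      rw [extMulVec_emb] at h1 h2
      rw [← hm] at h2
      have h1' : v i + (-b i).toNat = (A.mulVec x) i + (b i).toNat := by exact_mod_cast h1
      have h2' : (A.mulVec x) i ≤ m := by exact_mod_cast h2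
      exact Nat.cast_le.2 (by omega)
    have hge : (-b i).toNat ≤ m + (b i).toNat := by
      have h1 := hA' x₀ _ (Part.get_mem hx₀) i
      have h2 := extMulVec_mono A hxy i
      rw [extMulVec_emb] at h1 h2
      rw [← hm] at h2
      have h1' : ((relFun r x₀).get hx₀) i + (-b i).toNat = (A.mulVec x₀) i + (b i).toNat := by
        exact_mod_cast h1
      have h2' : (A.mulVec x₀) i ≤ m := by exact_mod_cast h2
      omega
    refine (add_le_add_left hzle _).trans ?_
    exact_mod_cast (Nat.sub_add_cancel hge).le
  · by_cases hex : ∃ j, A i j ≠ 0 ∧ y j = ⊤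
    · obtain ⟨j, hj, hyj⟩ := hex
      refine ENat.forall_natCast_le_iff_le.1 fun m _ => ?_
      refine le_trans ?_ (hle (a m) (had m) (hay m))
      rw [extMulVec_emb]
      have h1 : A i j * a m j ≤ (A.mulVec (a m)) i := by
        simp only [Matrix.mulVec, dotProduct]
        exact Finset.single_le_sum (f := fun j => A i j * a m j) (fun _ _ => Nat.zero_le _)
          (Finset.mem_univ j)
      have h2 : m ≤ a m j := by simp [a, hyj]
      have h3 : a m j ≤ A i j * a m j := Nat.le_mul_of_pos_left _ (Nat.pos_of_ne_zero hj)
      exact_mod_cast (by omega : m ≤ (A.mulVec (a m)) i + (b i).toNat)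
    · push Not at hex
      have heq : extMulVec A (emb (a 0)) i = extMulVec A y i := by
        refine Finset.sum_congr rfl fun j _ => ?_
        by_cases hj : A i j = 0
        · simp [hj]
        · simp [emb, a, hex j hj, ENat.natCast_toNat (hex j hj)]
      rw [← heq]
      exact hle _ (had 0) (hay 0)

end Affine

/-- By Dickson's lemma, finitely many elements of `U` suffice to decide which vectors are above some
element of `U`. -/
theorem exists_finite_basis {n : ℕ} (U : Set (Fin n → ℕ)) :
    ∃ B : List (Fin n → ℕ), ∀ y : Fin n → ℕ∞,
      (∃ x ∈ U, emb x ≤ y) ↔ ∃ x ∈ B, emb x ≤ y := by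
  have hfin : {x | Minimal (· ∈ U) x}.Finite :=
    WellQuasiOrderedLE.finite_of_isAntichain (setOfPred_minimal_antichain _)
  refine ⟨hfin.toFinset.toList, fun y => ⟨?_, ?_⟩⟩
  · rintro ⟨x, hx, hxy⟩
    obtain ⟨m, hmx, hm⟩ := exists_minimal_le_of_wellFoundedLT (· ∈ U) x hx
    exact ⟨m, by simpa using hm, (emb_le_emb.2 hmx).trans hxy⟩
  · rintro ⟨x, hx, hxy⟩
    have hx' : Minimal (· ∈ U) x := by simpa using hx
    exact ⟨x, hx'.prop, hxy⟩

/-! ### Effectivity of the completion -/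

section Transitions

variable {Q : Type*} {n : ℕ} {r : CounterRel n}

theorem liftMap_contExt_hasDependency (hr : IsPartialAffine r) (hup : IsUpperSet (relFun r).Dom)
    (p q : Q) : ∃ D, HasDependency (liftMap p (contExt (relFun r)) q) D := by
  obtain ⟨-, A, b, hA⟩ := hr
  refine ⟨fun i j => A i j ≠ 0, fun {s s'} hs i => ?_, fun {s t s' t'} hst hs ht i => ?_⟩
  · obtain ⟨-, -, h⟩ := mem_liftMap.1 hs
    have h1 := contExt_relFun_add hA hup h i
    rw [← extMulVec_eq_top_iff]
    constructor
    · intro h2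
      rw [h2, top_add] at h1
      simpa using h1.symm
    · intro h2
      rw [h2, top_add] at h1
      simpa using h1
  · obtain ⟨-, -, hs⟩ := mem_liftMap.1 hs
    obtain ⟨-, -, ht⟩ := mem_liftMap.1 ht
    have h1 := contExt_relFun_add hA hup hs i
    have h2 := contExt_relFun_add hA hup ht i
    rw [← ENat.add_lt_add_iff_right (ENat.natCast_ne_top (-b i).toNat), h1, h2,
      ENat.add_lt_add_iff_right (ENat.natCast_ne_top _), extMulVec_lt_iff A (state_le_iff.1 hst).2]
    refine and_congr_left fun _ => not_congr ?_
    constructor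
    · intro h3
      rw [h3, top_add] at h1
      simpa using h1
    · intro h3
      rw [h3, top_add] at h1
      simpa using h1.symm

variable [Finite Q]

theorem liftMap_contExt_primrecMap (hr : IsPartialAffine r) (hup : IsUpperSet (relFun r).Dom)
    (p q : Q) : PrimrecMap (liftMap p (contExt (relFun r)) q) := by
  classical
  obtain ⟨-, A, b, hA⟩ := hr
  obtain ⟨B, hB⟩ := exists_finite_basis (relFun r).Dom
  let v : State Q (Fin n → ℕ∞) → Fin n → ℕ∞ := fun s i =>
    extMulVec A s.2 i + ((b i).toNat : ℕ) - ((-b i).toNat : ℕ)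
  have hv : ∀ i, Primrec fun s => v s i := fun i =>
    (primrec_enat_sub_const _).comp (primrec_enat_add.comp
      (primrec_enat_sum _ fun j => (primrec_enat_mul_const (A i j)).comp (primrec_coord j))
      (Primrec.const _))
  have hdom : ∀ s, s ∈ (liftMap p (contExt (relFun r)) q).Dom ↔
      Finite.equivFin Q s.1 = Finite.equivFin Q p ∧ ∃ x ∈ B, ∀ i, (x i : ℕ∞) ≤ s.2 i := by
    intro s
    rw [mem_liftMap_dom, contExt_dom_of_isUpperSet _ hup, EmbeddingLike.apply_eq_iff_eq]
    exact and_congr_right fun _ => hB s.2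
  have hpred : PrimrecPred fun s : State Q (Fin n → ℕ∞) =>
      Finite.equivFin Q s.1 = Finite.equivFin Q p ∧ ∃ x ∈ B, ∀ i, (x i : ℕ∞) ≤ s.2 i :=
    (Primrec.eq.comp primrec_num (Primrec.const _)).and
      (primrecPred_exists_mem_list (fun x => primrecPred_forall_fin fun i =>
        primrecRel_enat_le.comp (Primrec.const _) (primrec_coord i)) B)
  have hval : ∀ s t, t ∈ liftMap p (contExt (relFun r)) q s → t = ⟨q, v s⟩ := by
    rintro s ⟨q', w⟩ ht
    obtain ⟨-, h1, h2⟩ := mem_liftMap.1 ht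
    obtain rfl : q' = q := h1
    congr 1
    funext i
    have h3 := contExt_relFun_add hA hup h2 i
    simp only [v, ← h3]
    exact ((ENat.addLECancellable_natCast _).add_tsub_cancel_right).symm
  refine ⟨fun s => if Finite.equivFin Q s.1 = Finite.equivFin Q p ∧
    ∃ x ∈ B, ∀ i, (x i : ℕ∞) ≤ s.2 i then some ⟨q, v s⟩ else none, ?_, fun s t => ?_⟩
  · exact Primrec.ite hpred
      (Primrec.option_some.comp (primrec_state_mk (Primrec.const _) hv)) (Primrec.const none)
  · change _ ↔ (if _ then _ else _) = _
    simp only [← hdom]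
    by_cases hs : s ∈ (liftMap p (contExt (relFun r)) q).Dom
    · rw [if_pos hs, Option.some.injEq]
      constructor
      · exact fun ht => (hval s t ht).symm
      · rintro rfl
        obtain ⟨t, ht⟩ := Part.dom_iff_mem.1 hs
        exact hval s t ht ▸ ht
    · rw [if_neg hs]
      simp only [reduceCtorEq, iff_false]
      exact fun ht => hs (Part.dom_iff_mem.2 ⟨t, ht⟩)

/-- Partial monotonicity, primitive recursiveness and the existence of a dependency relation are
shared by all compositions of transition maps, and together they make the acceleration computable. -/
theorem AffineCounterSystem.isInftyEffectiveCompleteWSTS (C : AffineCounterSystem Q n)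
    (h : C.UpwardClosedDomains) :
    C.completion.IsInftyEffectiveCompleteWSTS (stdRep Q n) := by
  have hmaps : ∀ f ∈ C.completion.maps,
      PartialMonotone f ∧ PrimrecMap f ∧ ∃ D, HasDependency f D := by
    rintro _ ⟨t, ht, rfl⟩
    have hr := C.affine _ (C.trans_rel t ht)
    exact ⟨liftMap_partialMonotone.2 (contExt_partialMonotone (h t ht)),
      liftMap_contExt_primrecMap hr (h t ht) _ _, liftMap_contExt_hasDependency hr (h t ht) _ _⟩
  refine ⟨C.isCompleteWSTS_completion h,
    ⟨stdRep_decidableOrder, fun f hf => (hmaps f hf).2.1.computableMap⟩, fun g hg => ?_⟩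
  have hcomp : PartialMonotone g ∧ PrimrecMap g ∧ ∃ D, HasDependency g D := by
    induction hg with
    | id =>
      refine ⟨⟨fun _ _ _ _ => trivial, fun s t s' t' hst hs ht => ?_⟩, PrimrecMap.id,
        _, HasDependency.id⟩
      rw [mem_pfun_id_iff] at hs ht
      rwa [hs, ht]
    | comp f g hf _ ih =>
      obtain ⟨hm, hp, D, hD⟩ := hmaps f hf
      obtain ⟨hm', hp', E, hE⟩ := ih
      exact ⟨hm.comp hm', hp.comp hp', _, hD.comp hE hm'⟩
  obtain ⟨hm, hp, D, hD⟩ := hcomp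
  exact (hp.accel hm hD).computableMap

end Transitions

end CounterSystems

theorem mainTheorem9 {Q : Type*} [Finite Q] {n : ℕ}
    (C : CounterSystems.AffineCounterSystem Q n) :
    (C.completion.IsInftyEffectiveCompleteWSTS (CounterSystems.stdRep Q n) ↔
      C.system.IsStronglyMonotonicWSTS) ∧
    ((∃ ρ : CounterSystems.Representation (CounterSystems.State Q (Fin n → ℕ∞)),
        C.completion.IsInftyEffectiveCompleteWSTS ρ) ↔
      C.system.IsStronglyMonotonicWSTS) ∧
    (C.system.IsStronglyMonotonicWSTS ↔ C.UpwardClosedDomains) := by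
  rw [C.isStronglyMonotonicWSTS_iff]
  refine ⟨⟨fun h => C.upwardClosedDomains_of_isCompleteWSTS h.1,
    C.isInftyEffectiveCompleteWSTS⟩, ⟨?_, fun h => ⟨_, C.isInftyEffectiveCompleteWSTS h⟩⟩, Iff.rfl⟩
  rintro ⟨ρ, h⟩
  exact C.upwardClosedDomains_of_isCompleteWSTS h.1
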